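/- Let $p\ge 2$ and let $(a_n)_{n\in\mathbb Z}$, $(b_n)_{n\in\mathbb Z}$ be real sequences with $a_{n+p}=a_n>0$ and $b_{n+p}=b_n$ for all $n\in\mathbb Z$. Let $J$ be the bounded self-adjoint operator on $\ell^2(\mathbb Z)$ given by $$(Jy)_n=a_{n-1}y_{n-1}+b_ny_n+a_ny_{n+1}.$$ The spectrum of $J$ is a union of $p$ compact real intervals $\sigma_i=[\lambda_i^-,\lambda_i^+]$ with $\lambda_i^-<\lambda_i^+$ for $1\le i\le p$ and $\lambda_i^+\le\lambda_{i+1}^-$ for $1\le i\le p-1$. For every such representation of the spectrum, the (possibly degenerate) gaps $\gamma_i=(\lambda_i^+,\lambda_{i+1}^-)$, of length $|\gamma_i|=\lambda_{i+1}^--\lambda_i^+$, satisfy $$\sum_{i=1}^{p-1}|\gamma_i|\ \ge\ \frac2p\Bigl(\max_n a_n-\min_n a_n\Bigr).$$ This improves the bound $p^2\sqrt p\,\max_i|\gamma_i|\ge\max_n a_n-\min_n a_n$, in the sense that moreover $$p^2\sqrt p\,\max_{1\le i\le p-1}|\gamma_i|\ \ge\ \frac p2\sum_{i=1}^{p-1}|\gamma_i|.$$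 -/

import Mathlib

noncomputable section

/-- The complex Hilbert space `ℓ²(ℤ)`. -/
abbrev EllTwo : Type := lp (fun _ : ℤ => ℂ) 2

/-- A bounded sequence of real numbers. -/
def IsBddSeq (c : ℤ → ℝ) : Prop := ∃ C : ℝ, ∀ n, |c n| ≤ C

theorem isBddSeq_of_periodic {p : ℕ} (hp : 0 < p) {c : ℤ → ℝ}
    (hc : Function.Periodic c (p : ℤ)) : IsBddSeq c := by
  refine ⟨∑ i ∈ Finset.range p, |c i|, fun n => ?_⟩
  have hp' : (0 : ℤ) < p := by exact_mod_cast hp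
  obtain ⟨y, hy, hcy⟩ := hc.exists_mem_Ico₀ hp' n
  rw [hcy]
  obtain ⟨k, rfl⟩ := Int.eq_ofNat_of_zero_le hy.1
  have hk : k ∈ Finset.range p := Finset.mem_range.2 (by exact_mod_cast hy.2)
  exact Finset.single_le_sum (f := fun i : ℕ => |c i|) (fun _ _ => abs_nonneg _) hk

theorem IsBddSeq.comp {c : ℤ → ℝ} (hc : IsBddSeq c) (f : ℤ → ℤ) :
    IsBddSeq (fun n => c (f n)) :=
  let ⟨C, hC⟩ := hc
  ⟨C, fun n => hC (f n)⟩

theorem weightedShift_bound {c : ℤ → ℝ} {C : ℝ} (hC : ∀ n, |c n| ≤ C) (e : ℤ ≃ ℤ)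
    (y : EllTwo) (n : ℤ) :
    ‖(c n : ℂ) * y (e n)‖ ^ (2 : ENNReal).toReal
      ≤ C ^ (2 : ENNReal).toReal * ‖y (e n)‖ ^ (2 : ENNReal).toReal := by
  have h0 : 0 ≤ C := (abs_nonneg _).trans (hC 0)
  rw [← Real.mul_rpow h0 (norm_nonneg _), norm_mul, Complex.norm_real, Real.norm_eq_abs]
  gcongr
  exact hC n

theorem weightedShift_summable (e : ℤ ≃ ℤ) (y : EllTwo) :
    Summable fun n => ‖y (e n)‖ ^ (2 : ENNReal).toReal :=
  (e.summable_iff (f := fun n => ‖y n‖ ^ (2 : ENNReal).toReal)).2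
    ((lp.memℓp y).summable (by norm_num))

theorem weightedShift_memlp {c : ℤ → ℝ} (hc : IsBddSeq c) (e : ℤ ≃ ℤ) (y : EllTwo) :
    Memℓp (fun n => (c n : ℂ) * y (e n)) 2 := by
  obtain ⟨C, hC⟩ := hc
  refine memℓp_gen (Summable.of_nonneg_of_le (fun n => by positivity)
    (weightedShift_bound hC e y) ?_)
  exact (weightedShift_summable e y).mul_left _

/-- The bounded operator `(W y)_n = c_n y_{e(n)}` on `ℓ²(ℤ)`, for a bounded sequence `c` and a
permutation `e` of `ℤ`. -/
def weightedShift (c : ℤ → ℝ) (hc : IsBddSeq c) (e : ℤ ≃ ℤ) : EllTwo →L[ℂ] EllTwo :=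
  LinearMap.mkContinuousOfExistsBound
    { toFun := fun y => ⟨fun n => (c n : ℂ) * y (e n), weightedShift_memlp hc e y⟩
      map_add' := fun x y => by
        ext n
        exact mul_add _ _ _
      map_smul' := fun r y => by
        ext n
        simp [mul_left_comm] }
    (by
      obtain ⟨C, hC⟩ := id hc
      have h0 : 0 ≤ C := (abs_nonneg _).trans (hC 0)
      refine ⟨C, fun y => ?_⟩
      have h2 : (0 : ℝ) < (2 : ENNReal).toReal := by norm_num
      refine lp.norm_le_of_tsum_le h2 (by positivity) ?_
      rw [Real.mul_rpow h0 (norm_nonneg _), lp.norm_rpow_eq_tsum h2 y,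
        ← e.tsum_eq (fun n => ‖y n‖ ^ (2 : ENNReal).toReal), ← tsum_mul_left]
      refine Summable.tsum_le_tsum (weightedShift_bound hC e y) ?_
        ((weightedShift_summable e y).mul_left _)
      exact (weightedShift_memlp hc e y).summable h2)

/-- The Jacobi operator `J(a,b)` on `ℓ²(ℤ)`,
`(J y)_n = a_{n-1} y_{n-1} + b_n y_n + a_n y_{n+1}`. -/
def jacobiOperator (a b : ℤ → ℝ) (ha : IsBddSeq a) (hb : IsBddSeq b) : EllTwo →L[ℂ] EllTwo :=
  weightedShift (fun n => a (n - 1)) (ha.comp _) (Equiv.subRight 1)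
    + weightedShift b hb (Equiv.refl ℤ)
    + weightedShift a ha (Equiv.addRight 1)

theorem jacobiOperator_apply (a b : ℤ → ℝ) (ha : IsBddSeq a) (hb : IsBddSeq b)
    (y : EllTwo) (n : ℤ) :
    jacobiOperator a b ha hb y n
      = (a (n - 1) : ℂ) * y (n - 1) + (b n : ℂ) * y n + (a n : ℂ) * y (n + 1) :=
  rfl

/-- `S` consists of the `p` real intervals (bands) `σ_i = [lo i, hi i]`, `i = 0, …, p - 1`, which
have positive length, are listed from left to right and do not overlap; the gap between `σ_i` and
`σ_{i+1}` is `(hi i, lo (i + 1))`, which is degenerate (empty) if `hi i = lo (i + 1)`.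
Only the values of `lo` and `hi` at `i < p` matter. -/
structure IsBandDecomposition (p : ℕ) (S : Set ℂ) (lo hi : ℕ → ℝ) : Prop where
  lo_lt_hi : ∀ i, i < p → lo i < hi i
  hi_le_lo : ∀ i, i + 1 < p → hi i ≤ lo (i + 1)
  eq_union : S = Complex.ofReal '' ⋃ i ∈ Finset.range p, Set.Icc (lo i) (hi i)

/-- The length `|γ_i|` of the gap between the `i`-th and the `(i+1)`-st band. -/
def gapLength (lo hi : ℕ → ℝ) (i : ℕ) : ℝ := lo (i + 1) - hi i

end

/-! Write `m` and `M` for the infimum and supremum of `a`. The sum of the gaps is the distance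
between the extreme band edges minus the total length of the bands, so it suffices to bound the
first from below and the second from above.

Floquet theory identifies the spectrum with the energies of quasi-periodic solutions whose
multiplier has modulus one, that is, with the eigenvalues of the Hermitian `p × p` matrices
`floquetMap a b p z`, `‖z‖ = 1` (`spectrum_jacobiOperator`). The multiplier enters such a matrix
only through its two corner entries, which contain a single off-diagonal coefficient `a n`.
Uniformly in `z`, the matrix lies between two fixed Hermitian matrices that differ by rank-one terms
of total trace `4 * a n`. By Weyl monotonicity the spectrum is covered by intervals of total length
`4 * a n`; since `n` is arbitrary, its measure is at most `4 * m` (`volume_floquetSpectrum_le`).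

For the width, the constant sequence and the alternating sequence are test vectors for the top and
the bottom of the spectrum. Subtracting their Rayleigh quotients cancels `b` and shows that the
width is at least `4` times the mean of `a` over a period, hence at least `4 * m + (2 / p) * (M -
m)`. Subtracting `4 * m` gives the estimate.

The existence of a band decomposition comes from ordered eigenvalues as continuous functions of the
quasi-momentum in `[0, π]`: constancy of the Wronskian makes an energy determine its quasi-momentum
and makes interior eigenvalues simple, so the bands are nondegenerate and do not overlap
(`exists_bands`). The comparison with the older bound is elementary. -/

namespace LinearMap.IsSymmetric

/-! ### Eigenvalue inequalities for symmetric operators in finite dimension -/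

variable {𝕜 E : Type*} [RCLike 𝕜] [NormedAddCommGroup E] [InnerProductSpace 𝕜 E]
  [FiniteDimensional 𝕜 E] {n : ℕ} {S T : E →ₗ[𝕜] E}

theorem inner_eigenvectorBasis_apply (hT : T.IsSymmetric) (hn : Module.finrank 𝕜 E = n) (v : E)
    (i : Fin n) :
    inner 𝕜 (hT.eigenvectorBasis hn i) (T v)
      = (hT.eigenvalues hn i : 𝕜) * inner 𝕜 (hT.eigenvectorBasis hn i) v := by
  rw [← hT, apply_eigenvectorBasis, inner_smul_left, RCLike.conj_ofReal]

theorem re_inner_eq_sum_eigenvalues (hT : T.IsSymmetric) (hn : Module.finrank 𝕜 E = n) (v : E) :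
    RCLike.re (inner 𝕜 v (T v))
      = ∑ i, hT.eigenvalues hn i * ‖inner 𝕜 (hT.eigenvectorBasis hn i) v‖ ^ 2 := by
  rw [← (hT.eigenvectorBasis hn).sum_inner_mul_inner, map_sum]
  refine Finset.sum_congr rfl fun i _ => ?_
  rw [inner_eigenvectorBasis_apply, mul_left_comm, RCLike.re_ofReal_mul, inner_mul_symm_re_eq_norm,
    norm_mul, norm_inner_symm, sq]

theorem re_inner_le_of_eigenvalues_le (hT : T.IsSymmetric) (hn : Module.finrank 𝕜 E = n) {v : E}
    {r : ℝ} (h : ∀ i, inner 𝕜 (hT.eigenvectorBasis hn i) v ≠ 0 → hT.eigenvalues hn i ≤ r) :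
    RCLike.re (inner 𝕜 v (T v)) ≤ r * ‖v‖ ^ 2 := by
  rw [re_inner_eq_sum_eigenvalues hT hn, ← (hT.eigenvectorBasis hn).sum_sq_norm_inner_right v,
    Finset.mul_sum]
  refine Finset.sum_le_sum fun i _ => ?_
  by_cases hi : inner 𝕜 (hT.eigenvectorBasis hn i) v = 0
  · simp [hi]
  · exact mul_le_mul_of_nonneg_right (h i hi) (by positivity)

theorem le_re_inner_of_le_eigenvalues (hT : T.IsSymmetric) (hn : Module.finrank 𝕜 E = n) {v : E}
    {r : ℝ} (h : ∀ i, inner 𝕜 (hT.eigenvectorBasis hn i) v ≠ 0 → r ≤ hT.eigenvalues hn i) :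
    r * ‖v‖ ^ 2 ≤ RCLike.re (inner 𝕜 v (T v)) := by
  rw [re_inner_eq_sum_eigenvalues hT hn, ← (hT.eigenvectorBasis hn).sum_sq_norm_inner_right v,
    Finset.mul_sum]
  refine Finset.sum_le_sum fun i _ => ?_
  by_cases hi : inner 𝕜 (hT.eigenvectorBasis hn i) v = 0
  · simp [hi]
  · exact mul_le_mul_of_nonneg_right (h i hi) (by positivity)

/-- Weyl's monotonicity principle. -/
theorem eigenvalues_le_add_of_re_inner_le (hS : S.IsSymmetric) (hT : T.IsSymmetric)
    (hn : Module.finrank 𝕜 E = n) {ε : ℝ}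
    (h : ∀ v, RCLike.re (inner 𝕜 v (S v)) ≤ RCLike.re (inner 𝕜 v (T v)) + ε * ‖v‖ ^ 2)
    (i : Fin n) : hS.eigenvalues hn i ≤ hT.eigenvalues hn i + ε := by
  -- There are only `n - 1` linear conditions, so some nonzero `v` satisfies them all. Eigenvalues
  -- are listed in decreasing order, hence such a `v` involves only `S`-eigenvalues at least the
  -- `i`-th and only `T`-eigenvalues at most the `i`-th.
  let L : E →ₗ[𝕜] ({j : Fin n // j ≠ i} → 𝕜) := LinearMap.pi fun j =>
    (innerSL 𝕜 (if i < j.1 then hS.eigenvectorBasis hn j else hT.eigenvectorBasis hn j)).toLinearMap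
  have hL : LinearMap.ker L ≠ ⊥ := by
    refine LinearMap.ker_ne_bot_of_finrank_lt ?_
    have : 0 < n := i.pos
    simp [hn, Fintype.card_subtype_compl]
    omega
  obtain ⟨v, hv, hv0⟩ := Submodule.exists_mem_ne_zero_of_ne_bot hL
  have hv' : ∀ j : Fin n, j ≠ i → inner 𝕜
      (if i < j then hS.eigenvectorBasis hn j else hT.eigenvectorBasis hn j) v = 0 :=
    fun j hj => congrFun (LinearMap.mem_ker.1 hv) ⟨j, hj⟩
  have h1 : hS.eigenvalues hn i * ‖v‖ ^ 2 ≤ RCLike.re (inner 𝕜 v (S v)) := by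
    refine hS.le_re_inner_of_le_eigenvalues hn fun j hj => ?_
    refine hS.eigenvalues_antitone hn (not_lt.1 fun hij => hj ?_)
    simpa [hij] using hv' j hij.ne'
  have h2 : RCLike.re (inner 𝕜 v (T v)) ≤ hT.eigenvalues hn i * ‖v‖ ^ 2 := by
    refine hT.re_inner_le_of_eigenvalues_le hn fun j hj => ?_
    refine hT.eigenvalues_antitone hn (not_lt.1 fun hij => hj ?_)
    simpa [hij.not_gt] using hv' j hij.ne
  have h3 : 0 < ‖v‖ ^ 2 := by positivity
  nlinarith [h v]

theorem mul_norm_le_norm_sub_of_le_abs_sub (hT : T.IsSymmetric) (hn : Module.finrank 𝕜 E = n)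
    {r d : ℝ} (hd : 0 ≤ d) (h : ∀ i, d ≤ |hT.eigenvalues hn i - r|) (v : E) :
    d * ‖v‖ ≤ ‖T v - (r : 𝕜) • v‖ := by
  refine le_of_sq_le_sq ?_ (norm_nonneg _)
  rw [mul_pow, ← (hT.eigenvectorBasis hn).sum_sq_norm_inner_right v,
    ← (hT.eigenvectorBasis hn).sum_sq_norm_inner_right, Finset.mul_sum]
  refine Finset.sum_le_sum fun i _ => ?_
  rw [inner_sub_right, inner_smul_right, inner_eigenvectorBasis_apply, ← sub_mul, norm_mul, mul_pow,
    ← RCLike.ofReal_sub, RCLike.norm_ofReal]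
  gcongr
  exact h i

end LinearMap.IsSymmetric
-- Quasi-periodic sequences and Floquet matrices
noncomputable section

/-- The Jacobi difference expression acting on arbitrary complex sequences. -/
def jacobiMap (a b : ℤ → ℝ) : (ℤ → ℂ) →ₗ[ℂ] (ℤ → ℂ) where
  toFun u n := (a (n - 1) : ℂ) * u (n - 1) + (b n : ℂ) * u n + (a n : ℂ) * u (n + 1)
  map_add' u w := by ext n; simp only [Pi.add_apply]; ring
  map_smul' c u := by ext n; simp only [Pi.smul_apply, smul_eq_mul, RingHom.id_apply]; ring

theorem jacobiMap_apply (a b : ℤ → ℝ) (u : ℤ → ℂ) (n : ℤ) :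
    jacobiMap a b u n
      = (a (n - 1) : ℂ) * u (n - 1) + (b n : ℂ) * u n + (a n : ℂ) * u (n + 1) := rfl

/-- `u` is a quasi-periodic sequence of period `q` with multiplier `z`. -/
def IsQuasiPeriodic (q : ℕ) (z : ℂ) (u : ℤ → ℂ) : Prop := ∀ n, u (n + q) = z * u n

theorem IsQuasiPeriodic.apply_add_mul {q : ℕ} {z : ℂ} {u : ℤ → ℂ} (hu : IsQuasiPeriodic q z u)
    (hz : z ≠ 0) (n m : ℤ) : u (n + m * q) = z ^ m * u n := by
  induction m with
  | zero => simp
  | succ m ih => rw [add_mul, one_mul, ← add_assoc, hu, ih, zpow_add_one₀ hz]; ring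
  | pred m ih =>
    have := hu (n + (-m - 1 : ℤ) * q)
    rw [show n + (-m - 1 : ℤ) * q + q = n + (-m : ℤ) * q by ring, ih] at this
    rw [zpow_sub_one₀ hz, mul_right_comm, this]
    field_simp

theorem IsQuasiPeriodic.jacobiMap {a b : ℤ → ℝ} {q : ℕ} {z : ℂ} {u : ℤ → ℂ}
    (hu : IsQuasiPeriodic q z u) (ha : Function.Periodic a (q : ℤ))
    (hb : Function.Periodic b (q : ℤ)) : IsQuasiPeriodic q z (jacobiMap a b u) := fun n => by
  rw [jacobiMap_apply, jacobiMap_apply, hb, ha, hu, add_right_comm n _ 1, hu,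
    add_sub_right_comm n _ 1, hu, ha]
  ring

/-- The `z`-quasi-periodic extension of a vector. -/
def floquetExtend (q : ℕ) [NeZero q] (z : ℂ) : EuclideanSpace ℂ (Fin q) →ₗ[ℂ] (ℤ → ℂ) where
  toFun v n := z ^ (n / q) * v (Fin.ofNat q (n % q).toNat)
  map_add' v w := by ext n; simp [mul_add]
  map_smul' c v := by ext n; simp [mul_left_comm]

/-- The restriction of a sequence to one period. -/
def floquetRestrict (q : ℕ) : (ℤ → ℂ) →ₗ[ℂ] EuclideanSpace ℂ (Fin q) where
  toFun u := WithLp.toLp 2 fun k => u (k : ℕ)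
  map_add' u w := by ext n; simp
  map_smul' c v := by ext n; simp

@[simp] theorem floquetRestrict_apply (q : ℕ) (u : ℤ → ℂ) (k : Fin q) :
    floquetRestrict q u k = u (k : ℕ) := rfl

section

variable {q : ℕ} [NeZero q] {z : ℂ}

theorem floquetExtend_apply (v : EuclideanSpace ℂ (Fin q)) (n : ℤ) :
    floquetExtend q z v n = z ^ (n / q) * v (Fin.ofNat q (n % q).toNat) := rfl

theorem natCast_pos_of_neZero (q : ℕ) [NeZero q] : (0 : ℤ) < q := by
  exact_mod_cast Nat.pos_of_ne_zero (NeZero.ne q)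

theorem floquetExtend_natCast (v : EuclideanSpace ℂ (Fin q)) {k : ℕ} (hk : k < q) :
    floquetExtend q z v k = v ⟨k, hk⟩ := by
  have h : ((k : ℤ) % q).toNat = k := by
    rw [Int.emod_eq_of_lt (by omega) (by omega)]; simp
  rw [floquetExtend_apply, Int.ediv_eq_zero_of_lt (by omega) (by omega), h]
  simp only [zpow_zero, one_mul]
  exact congrArg (fun i => v i) (Fin.ext (Nat.mod_eq_of_lt hk))

theorem floquetRestrict_floquetExtend (v : EuclideanSpace ℂ (Fin q)) :
    floquetRestrict q (floquetExtend q z v) = v := by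
  ext k
  rw [floquetRestrict_apply, floquetExtend_natCast v k.2]

theorem isQuasiPeriodic_floquetExtend (hz : z ≠ 0) (v : EuclideanSpace ℂ (Fin q)) :
    IsQuasiPeriodic q z (floquetExtend q z v) := fun n => by
  have := natCast_pos_of_neZero q
  rw [floquetExtend_apply, floquetExtend_apply, Int.add_emod_right,
    Int.add_ediv_of_dvd_right dvd_rfl, Int.ediv_self this.ne', zpow_add_one₀ hz]
  ring

theorem floquetExtend_floquetRestrict (hz : z ≠ 0) {u : ℤ → ℂ} (hu : IsQuasiPeriodic q z u) :
    floquetExtend q z (floquetRestrict q u) = u := by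
  ext n
  have hq := natCast_pos_of_neZero q
  have h0 := Int.emod_nonneg n hq.ne'
  have h1 := Int.emod_lt_of_pos n hq
  rw [floquetExtend_apply, floquetRestrict_apply]
  conv_rhs => rw [← Int.emod_add_ediv_mul n q, hu.apply_add_mul hz]
  congr 2
  simp only [Fin.val_ofNat]
  rw [Nat.mod_eq_of_lt (by omega)]
  omega

theorem floquetExtend_injective : Function.Injective (floquetExtend q z) :=
  Function.LeftInverse.injective floquetRestrict_floquetExtend

/-- The Jacobi operator on `z`-quasi-periodic sequences, in terms of their values on one period. -/
def floquetMap (a b : ℤ → ℝ) (q : ℕ) [NeZero q] (z : ℂ) :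
    EuclideanSpace ℂ (Fin q) →ₗ[ℂ] EuclideanSpace ℂ (Fin q) :=
  floquetRestrict q ∘ₗ jacobiMap a b ∘ₗ floquetExtend q z

theorem floquetMap_apply (a b : ℤ → ℝ) (v : EuclideanSpace ℂ (Fin q)) (k : Fin q) :
    floquetMap a b q z v k = jacobiMap a b (floquetExtend q z v) (k : ℕ) := rfl

theorem floquetExtend_floquetMap {a b : ℤ → ℝ} (ha : Function.Periodic a (q : ℤ))
    (hb : Function.Periodic b (q : ℤ)) (hz : z ≠ 0) (v : EuclideanSpace ℂ (Fin q)) :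
    floquetExtend q z (floquetMap a b q z v) = jacobiMap a b (floquetExtend q z v) :=
  floquetExtend_floquetRestrict hz ((isQuasiPeriodic_floquetExtend hz v).jacobiMap ha hb)

end

/-- Discrete Green formula: the sum telescopes to boundary terms. Applied to a quasi-periodic
sequence and the conjugate of another one with the same unimodular multiplier, the two boundary
terms cancel, which makes the Floquet matrix symmetric. -/
theorem sum_jacobiMap_mul_sub (a b : ℤ → ℝ) (u w : ℤ → ℂ) (q : ℕ) :
    ∑ k ∈ Finset.range q, (jacobiMap a b u k * w k - u k * jacobiMap a b w k)
      = (a (q - 1) : ℂ) * (u q * w (q - 1) - u (q - 1) * w q)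
        - (a (-1) : ℂ) * (u 0 * w (-1) - u (-1) * w 0) := by
  induction q with
  | zero => simp
  | succ q ih =>
    rw [Finset.sum_range_succ, ih, jacobiMap_apply, jacobiMap_apply]
    push_cast
    rw [add_sub_cancel_right]
    ring

theorem conj_jacobiMap (a b : ℤ → ℝ) (u : ℤ → ℂ) (n : ℤ) :
    starRingEnd ℂ (jacobiMap a b u n) = jacobiMap a b (fun k => starRingEnd ℂ (u k)) n := by
  simp [jacobiMap_apply]

theorem IsQuasiPeriodic.conj {q : ℕ} {z : ℂ} {u : ℤ → ℂ} (hu : IsQuasiPeriodic q z u) :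
    IsQuasiPeriodic q (starRingEnd ℂ z) fun k => starRingEnd ℂ (u k) := fun n => by
  simp [hu n]

theorem inner_eq_sum_range {q : ℕ} (u w : ℤ → ℂ) :
    inner ℂ (floquetRestrict q u) (floquetRestrict q w)
      = ∑ k ∈ Finset.range q, w k * starRingEnd ℂ (u k) := by
  rw [PiLp.inner_apply, ← Fin.sum_univ_eq_sum_range (fun k => w k * starRingEnd ℂ (u k))]
  simp

theorem isSymmetric_floquetMap {q : ℕ} [NeZero q] {z : ℂ} {a b : ℤ → ℝ} (ha : Function.Periodic a (q : ℤ)) (hz : ‖z‖ = 1) :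
    (floquetMap a b q z).IsSymmetric := fun v w => by
  have hz0 : z ≠ 0 := norm_ne_zero_iff.1 (by simp [hz])
  have hv := isQuasiPeriodic_floquetExtend hz0 v
  have hw := isQuasiPeriodic_floquetExtend hz0 w
  have ev : v = floquetRestrict q (floquetExtend q z v) := (floquetRestrict_floquetExtend v).symm
  have ew : w = floquetRestrict q (floquetExtend q z w) := (floquetRestrict_floquetExtend w).symm
  rw [floquetMap, LinearMap.comp_apply, LinearMap.comp_apply, LinearMap.comp_apply,
    LinearMap.comp_apply]
  set u := floquetExtend q z v
  set y := floquetExtend q z w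
  rw [ev, ew, inner_eq_sum_range, inner_eq_sum_range, eq_comm, ← sub_eq_zero,
    ← Finset.sum_sub_distrib]
  simp_rw [conj_jacobiMap]
  rw [sum_jacobiMap_mul_sub a b y fun k => starRingEnd ℂ (u k)]
  have hzz : z * starRingEnd ℂ z = 1 := by simp [Complex.mul_conj, Complex.normSq_eq_norm_sq, hz]
  have e1 := hv (-1)
  have e2 := hv 0
  have e3 := hw (-1)
  have e4 := hw 0
  have e5 := ha (-1)
  rw [show (-1 : ℤ) + q = q - 1 by ring] at e1 e3 e5
  rw [zero_add] at e2 e4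
  rw [e1, e2, e3, e4, e5]
  simp only [map_mul]
  linear_combination (a (-1) : ℂ) * (y 0 * starRingEnd ℂ (u (-1))
    - y (-1) * starRingEnd ℂ (u 0)) * hzz

/-- The energies of bounded Floquet solutions of the periodic Jacobi equation. -/
def floquetSpectrum (a b : ℤ → ℝ) (p : ℕ) : Set ℝ :=
  {r | ∃ z : ℂ, ‖z‖ = 1 ∧ ∃ u : ℤ → ℂ, u ≠ 0 ∧ IsQuasiPeriodic p z u ∧
    jacobiMap a b u = (r : ℂ) • u}

theorem hasEigenvalue_floquetMap_iff {a b : ℤ → ℝ} {q : ℕ} [NeZero q] {z : ℂ}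
    (ha : Function.Periodic a (q : ℤ)) (hb : Function.Periodic b (q : ℤ)) (hz : z ≠ 0) {r : ℂ} :
    Module.End.HasEigenvalue (floquetMap a b q z) r ↔
      ∃ u : ℤ → ℂ, u ≠ 0 ∧ IsQuasiPeriodic q z u ∧ jacobiMap a b u = r • u := by
  constructor
  · intro h
    obtain ⟨v, hv⟩ := h.exists_hasEigenvector
    refine ⟨floquetExtend q z v, ?_, isQuasiPeriodic_floquetExtend hz v, ?_⟩
    · exact fun h0 => hv.2 (floquetExtend_injective (h0.trans (map_zero _).symm))
    · rw [← floquetExtend_floquetMap ha hb hz, hv.apply_eq_smul, map_smul]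
  · rintro ⟨u, hu0, hu, he⟩
    refine Module.End.hasEigenvalue_of_hasEigenvector (x := floquetRestrict q u)
      ⟨Module.End.mem_eigenspace_iff.2 ?_, fun h => hu0 ?_⟩
    · rw [floquetMap, LinearMap.comp_apply, LinearMap.comp_apply,
        floquetExtend_floquetRestrict hz hu, he, map_smul]
    · rw [← floquetExtend_floquetRestrict hz hu, h, map_zero]

/-! ### Wronskian and uniqueness of the multiplier -/

theorem eq_zero_of_jacobiMap_eq_smul {a b : ℤ → ℝ} (ha : ∀ n, a n ≠ 0) {r : ℂ} {u : ℤ → ℂ}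
    (hu : jacobiMap a b u = r • u) (h0 : u 0 = 0) (h1 : u 1 = 0) : u = 0 := by
  have key : ∀ n : ℤ, u n = 0 ∧ u (n + 1) = 0 := fun n => by
    induction n with
    | zero => exact ⟨h0, by simpa using h1⟩
    | succ n ih =>
      refine ⟨ih.2, ?_⟩
      have := congrFun hu (n + 1)
      simpa [jacobiMap_apply, ih.1, ih.2, ha] using this
    | pred n ih =>
      rw [sub_add_cancel]
      refine ⟨?_, ih.1⟩
      have := congrFun hu (-n)
      simpa [jacobiMap_apply, ih.1, ih.2, ha] using this
  exact funext fun n => (key n).1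

theorem wronskian_eq {a b : ℤ → ℝ} {r : ℂ} {u w : ℤ → ℂ}
    (hu : jacobiMap a b u = r • u) (hw : jacobiMap a b w = r • w) (n : ℤ) :
    (a n : ℂ) * (u n * w (n + 1) - u (n + 1) * w n) = (a 0 : ℂ) * (u 0 * w 1 - u 1 * w 0) := by
  have step : ∀ n : ℤ, (a n : ℂ) * (u n * w (n + 1) - u (n + 1) * w n)
      = (a (n - 1) : ℂ) * (u (n - 1) * w n - u n * w (n - 1)) := fun n => by
    have e1 := congrFun hu n
    have e2 := congrFun hw n
    simp only [jacobiMap_apply, Pi.smul_apply, smul_eq_mul] at e1 e2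
    linear_combination u n * e2 - w n * e1
  induction n with
  | zero => simp
  | succ n ih => rw [step, ← ih, add_sub_cancel_right]
  | pred n ih => rw [← ih, step (-n), sub_add_cancel]

/-- The Wronskian is constant, yet translation by one period multiplies it by `z * z'`. It therefore
vanishes when `z * z' ≠ 1`, and the initial data at `0` and `1` are proportional. -/
theorem exists_eq_smul_of_isQuasiPeriodic {a b : ℤ → ℝ} {p : ℕ} (hp : Function.Periodic a (p : ℤ))
    (ha : ∀ n, a n ≠ 0) {r z z' : ℂ} {u w : ℤ → ℂ}
    (hu : jacobiMap a b u = r • u) (hw : jacobiMap a b w = r • w) (hu0 : u ≠ 0)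
    (hzu : IsQuasiPeriodic p z u) (hzw : IsQuasiPeriodic p z' w) (hzz : z * z' ≠ 1) :
    ∃ c : ℂ, w = c • u := by
  have hW : u 0 * w 1 - u 1 * w 0 = 0 := by
    have h := wronskian_eq hu hw p
    have e1 := hzu 0
    have e2 := hzu 1
    have e3 := hzw 0
    have e4 := hzw 1
    have e5 := hp 0
    rw [zero_add] at e1 e3 e5
    rw [add_comm] at e2 e4
    rw [e1, e2, e3, e4, e5] at h
    have h' : (1 - z * z') * ((a 0 : ℂ) * (u 0 * w 1 - u 1 * w 0)) = 0 := by
      linear_combination -h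
    simpa [sub_eq_zero, hzz.symm, ha 0] using h'
  have key : ∀ c : ℂ, w 0 = c * u 0 → w 1 = c * u 1 → ∃ c : ℂ, w = c • u := fun c h0 h1 =>
    ⟨c, sub_eq_zero.1 (eq_zero_of_jacobiMap_eq_smul (b := b) ha (r := r)
      (by rw [map_sub, map_smul, hu, hw, smul_sub, smul_comm])
      (by simp [h0]) (by simp [h1]))⟩
  by_cases h0 : u 0 = 0
  · have h1 : u 1 ≠ 0 := fun h1 => hu0 (eq_zero_of_jacobiMap_eq_smul ha hu h0 h1)
    refine key (w 1 / u 1) ?_ (by field_simp)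
    rw [h0, zero_mul, zero_sub, neg_eq_zero, mul_eq_zero] at hW
    simp [h0, hW.resolve_left h1]
  · refine key (w 0 / u 0) (by field_simp) ?_
    field_simp
    linear_combination hW

theorem multiplier_eq_of_mul_ne_one {a b : ℤ → ℝ} {p : ℕ} (hp : Function.Periodic a (p : ℤ))
    (ha : ∀ n, a n ≠ 0) {r z z' : ℂ} {u w : ℤ → ℂ}
    (hu : jacobiMap a b u = r • u) (hw : jacobiMap a b w = r • w) (hu0 : u ≠ 0) (hw0 : w ≠ 0)
    (hzu : IsQuasiPeriodic p z u) (hzw : IsQuasiPeriodic p z' w) (hzz : z * z' ≠ 1) :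
    z = z' := by
  obtain ⟨c, rfl⟩ := exists_eq_smul_of_isQuasiPeriodic hp ha hu hw hu0 hzu hzw hzz
  obtain ⟨n, hn⟩ := Function.ne_iff.1 hw0
  have := hzw n
  simp only [Pi.smul_apply, smul_eq_mul, Pi.zero_apply] at this hn
  rw [hzu] at this
  refine mul_right_cancel₀ hn ?_
  linear_combination this


/-! ### Dependence of the Floquet matrix on the multiplier -/

theorem floquetExtend_sub_one_sub {q : ℕ} [NeZero q] {z w : ℂ} (hz : z ≠ 0) (hw : w ≠ 0)
    (v : EuclideanSpace ℂ (Fin q)) (k : Fin q) :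
    floquetExtend q z v ((k : ℕ) - 1) - floquetExtend q w v ((k : ℕ) - 1)
      = if k = 0 then (z⁻¹ - w⁻¹) * v (Fin.rev 0) else 0 := by
  have hq := Nat.pos_of_ne_zero (NeZero.ne q)
  have hrev : (⟨q - 1, by omega⟩ : Fin q) = Fin.rev 0 := by ext; simp
  have key : ∀ z : ℂ, z ≠ 0 → floquetExtend q z v (-1) = z⁻¹ * v (Fin.rev 0) := fun z hz => by
    have h := isQuasiPeriodic_floquetExtend hz v (-1)
    rw [show (-1 : ℤ) + q = (q - 1 : ℕ) by omega, floquetExtend_natCast v (by omega), hrev] at h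
    rw [h, inv_mul_cancel_left₀ hz]
  split_ifs with hk
  · subst hk
    simp only [Fin.val_zero, Nat.cast_zero, zero_sub]
    rw [key z hz, key w hw, sub_mul]
  · have : (k : ℕ) ≠ 0 := fun h => hk (Fin.ext (by simpa using h))
    rw [show ((k : ℕ) : ℤ) - 1 = (k - 1 : ℕ) by omega, floquetExtend_natCast v (by omega),
      floquetExtend_natCast v (by omega), sub_self]

theorem floquetExtend_add_one_sub {q : ℕ} [NeZero q] {z w : ℂ} (hz : z ≠ 0) (hw : w ≠ 0)
    (v : EuclideanSpace ℂ (Fin q)) (k : Fin q) :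
    floquetExtend q z v ((k : ℕ) + 1) - floquetExtend q w v ((k : ℕ) + 1)
      = if k = Fin.rev 0 then (z - w) * v 0 else 0 := by
  have hq := Nat.pos_of_ne_zero (NeZero.ne q)
  have key : ∀ z : ℂ, z ≠ 0 → floquetExtend q z v q = z * v 0 := fun z hz => by
    have h := isQuasiPeriodic_floquetExtend hz v 0
    rw [zero_add] at h
    rw [h, ← Nat.cast_zero, floquetExtend_natCast v hq]
    rfl
  split_ifs with hk
  · subst hk
    rw [show (((Fin.rev 0 : Fin q) : ℕ) : ℤ) + 1 = q by simp; omega, key z hz, key w hw, sub_mul]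
  · have : (k : ℕ) ≠ q - 1 := fun h => hk (Fin.ext (by simpa using h))
    rw [← Nat.cast_succ, floquetExtend_natCast v (by omega), floquetExtend_natCast v (by omega),
      sub_self]

/-- Only the first and the last site have a neighbour outside the period, so only the two corner
terms depend on the multiplier; both carry the coefficient `a (-1)`. -/
theorem floquetMap_apply_sub {a b : ℤ → ℝ} {q : ℕ} [NeZero q] (ha : Function.Periodic a (q : ℤ))
    {z w : ℂ} (hz : z ≠ 0) (hw : w ≠ 0) (v : EuclideanSpace ℂ (Fin q)) (k : Fin q) :
    floquetMap a b q z v k - floquetMap a b q w v k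
      = (if k = 0 then (a (-1) : ℂ) * ((z⁻¹ - w⁻¹) * v (Fin.rev 0)) else 0)
        + if k = Fin.rev 0 then (a (-1) : ℂ) * ((z - w) * v 0) else 0 := by
  have hq := Nat.pos_of_ne_zero (NeZero.ne q)
  have e0 : floquetExtend q z v (k : ℕ) = floquetExtend q w v (k : ℕ) := by
    rw [floquetExtend_natCast v k.2, floquetExtend_natCast v k.2]
  have e1 := floquetExtend_sub_one_sub hz hw v k
  have e2 := floquetExtend_add_one_sub hz hw v k
  rw [floquetMap_apply, floquetMap_apply, jacobiMap_apply, jacobiMap_apply, e0]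
  have e3 : ∀ x : ℂ, (if k = 0 then (a (-1) : ℂ) * x else 0)
      = (a ((k : ℕ) - 1) : ℂ) * if k = 0 then x else 0 := fun x => by
    split_ifs with h
    · simp [h]
    · simp
  have e4 : ∀ x : ℂ, (if k = Fin.rev 0 then (a (-1) : ℂ) * x else 0)
      = (a (k : ℕ) : ℂ) * if k = Fin.rev 0 then x else 0 := fun x => by
    split_ifs with h
    · have h5 := ha (-1)
      rw [show (-1 : ℤ) + q = (k : ℕ) by rw [h]; simp; omega] at h5
      rw [h5]
    · simp
  rw [e3, e4, ← e1, ← e2]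
  ring

/-- On the unit circle inversion is conjugation, so the two corner contributions are complex
conjugates and add up to twice a real part. -/
theorem re_inner_floquetMap {a b : ℤ → ℝ} {q : ℕ} [NeZero q] (ha : Function.Periodic a (q : ℤ))
    {z w : ℂ} (hz : ‖z‖ = 1) (hw : ‖w‖ = 1) (v : EuclideanSpace ℂ (Fin q)) :
    RCLike.re (inner ℂ v (floquetMap a b q z v))
      = RCLike.re (inner ℂ v (floquetMap a b q w v))
        + 2 * a (-1) * ((z - w) * (v 0 * starRingEnd ℂ (v (Fin.rev 0)))).re := by
  have hz0 : z ≠ 0 := norm_ne_zero_iff.1 (by simp [hz])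
  have hw0 : w ≠ 0 := norm_ne_zero_iff.1 (by simp [hw])
  have key : inner ℂ v (floquetMap a b q z v) - inner ℂ v (floquetMap a b q w v)
      = (a (-1) : ℂ) * ((z⁻¹ - w⁻¹) * v (Fin.rev 0)) * starRingEnd ℂ (v 0)
        + (a (-1) : ℂ) * ((z - w) * v 0) * starRingEnd ℂ (v (Fin.rev 0)) := by
    rw [PiLp.inner_apply, PiLp.inner_apply, ← Finset.sum_sub_distrib]
    simp_rw [← inner_sub_right, floquetMap_apply_sub ha hz0 hw0, RCLike.inner_apply, add_mul,
      ite_mul, zero_mul]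
    rw [Finset.sum_add_distrib]
    simp
  rw [Complex.inv_def, Complex.inv_def, Complex.normSq_eq_norm_sq, Complex.normSq_eq_norm_sq, hz,
    hw] at key
  have := congrArg Complex.re key
  simp only [Complex.sub_re, Complex.add_re, Complex.mul_re, Complex.mul_im, Complex.conj_re,
    Complex.conj_im, Complex.ofReal_re, Complex.ofReal_im, Complex.sub_im] at this
  simp only [RCLike.re_to_complex, Complex.mul_re, Complex.mul_im, Complex.conj_re,
    Complex.conj_im, Complex.sub_re, Complex.sub_im]
  norm_num at this
  linear_combination this

/-! ### Band functions -/

/-- The `i`-th smallest energy of the Floquet solutions with quasi-momentum `θ`. -/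
def bandFunction (a b : ℤ → ℝ) (q : ℕ) [NeZero q] (ha : Function.Periodic a (q : ℤ)) (i : ℕ)
    (θ : ℝ) : ℝ :=
  if h : i < q then
    (isSymmetric_floquetMap (b := b) ha (Complex.norm_exp_ofReal_mul_I θ)).eigenvalues finrank_euclideanSpace_fin
      (Fin.rev ⟨i, h⟩)
  else 0

section

variable {a b : ℤ → ℝ} {q : ℕ} [NeZero q]

theorem bandFunction_of_lt (ha : Function.Periodic a (q : ℤ)) {i : ℕ} (h : i < q) (θ : ℝ) :
    bandFunction a b q ha i θ = (isSymmetric_floquetMap (b := b) ha (Complex.norm_exp_ofReal_mul_I θ)).eigenvalues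
      finrank_euclideanSpace_fin (Fin.rev ⟨i, h⟩) := dif_pos h

theorem bandFunction_le_succ (ha : Function.Periodic a (q : ℤ)) {i : ℕ} (h : i + 1 < q) (θ : ℝ) :
    bandFunction a b q ha i θ ≤ bandFunction a b q ha (i + 1) θ := by
  rw [bandFunction_of_lt ha h, bandFunction_of_lt ha (by omega)]
  -- `eigenvalues` is decreasing, and the index reversal in `bandFunction` makes the order
  -- increasing.
  refine LinearMap.IsSymmetric.eigenvalues_antitone _ _ ?_
  rw [Fin.rev_le_rev]
  exact Nat.le_succ i

/-- Weyl monotonicity applied to the corner perturbation, whose quadratic form is controlled by the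
difference of the multipliers. This gives continuity of each ordered eigenvalue. -/
theorem bandFunction_le_add (ha : Function.Periodic a (q : ℤ)) {i : ℕ} (h : i < q) (θ η : ℝ) :
    bandFunction a b q ha i θ ≤ bandFunction a b q ha i η
      + 2 * |a (-1)| * ‖Complex.exp (θ * Complex.I) - Complex.exp (η * Complex.I)‖ := by
  rw [bandFunction_of_lt ha h, bandFunction_of_lt ha h]
  refine LinearMap.IsSymmetric.eigenvalues_le_add_of_re_inner_le _ _ _ (fun v => ?_) _
  rw [re_inner_floquetMap ha (Complex.norm_exp_ofReal_mul_I θ) (Complex.norm_exp_ofReal_mul_I η)]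
  rw [add_le_add_iff_left]
  refine (le_abs_self _).trans ?_
  rw [abs_mul, abs_mul, abs_two, mul_assoc _ ‖_‖]
  gcongr
  refine (Complex.abs_re_le_norm _).trans ?_
  rw [norm_mul, norm_mul, RCLike.norm_conj]
  gcongr
  rw [sq]
  gcongr
  · exact PiLp.norm_apply_le v _
  · exact PiLp.norm_apply_le v _

theorem continuous_bandFunction (ha : Function.Periodic a (q : ℤ)) {i : ℕ} (h : i < q) :
    Continuous (bandFunction a b q ha i) := by
  rw [continuous_iff_continuousAt]
  intro η
  rw [ContinuousAt, tendsto_iff_dist_tendsto_zero]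
  have hc : Filter.Tendsto (fun θ : ℝ => 2 * |a (-1)| *
      ‖Complex.exp (θ * Complex.I) - Complex.exp (η * Complex.I)‖) (nhds η) (nhds 0) := by
    have : Continuous fun θ : ℝ => 2 * |a (-1)| *
      ‖Complex.exp (θ * Complex.I) - Complex.exp (η * Complex.I)‖ := by fun_prop
    simpa using this.tendsto η
  refine squeeze_zero (fun _ => dist_nonneg) (fun θ => ?_) hc
  rw [Real.dist_eq, abs_le]
  have h1 := bandFunction_le_add (b := b) ha h θ η
  have h2 := bandFunction_le_add (b := b) ha h η θ
  rw [norm_sub_rev] at h2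
  constructor <;> linarith

theorem exists_floquet_solution (ha : Function.Periodic a (q : ℤ))
    (hb : Function.Periodic b (q : ℤ)) {i : ℕ} (h : i < q) (θ : ℝ) :
    ∃ u : ℤ → ℂ, u ≠ 0 ∧ IsQuasiPeriodic q (Complex.exp (θ * Complex.I)) u ∧
      jacobiMap a b u = (bandFunction a b q ha i θ : ℂ) • u := by
  rw [← hasEigenvalue_floquetMap_iff ha hb (Complex.exp_ne_zero _), bandFunction_of_lt ha h]
  exact LinearMap.IsSymmetric.hasEigenvalue_eigenvalues _ _ _

theorem bandFunction_mem_floquetSpectrum (ha : Function.Periodic a (q : ℤ))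
    (hb : Function.Periodic b (q : ℤ)) {i : ℕ} (h : i < q) (θ : ℝ) :
    bandFunction a b q ha i θ ∈ floquetSpectrum a b q :=
  ⟨_, Complex.norm_exp_ofReal_mul_I θ, exists_floquet_solution ha hb h θ⟩

theorem exists_bandFunction_eq (ha : Function.Periodic a (q : ℤ))
    (hb : Function.Periodic b (q : ℤ)) {θ r : ℝ} {u : ℤ → ℂ} (hu0 : u ≠ 0)
    (hu : IsQuasiPeriodic q (Complex.exp (θ * Complex.I)) u) (he : jacobiMap a b u = (r : ℂ) • u) :
    ∃ i < q, bandFunction a b q ha i θ = r := by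
  obtain ⟨i, hi⟩ := (isSymmetric_floquetMap (b := b) ha (Complex.norm_exp_ofReal_mul_I θ)).exists_eigenvalues_eq
    finrank_euclideanSpace_fin
    ((hasEigenvalue_floquetMap_iff ha hb (Complex.exp_ne_zero _)).2 ⟨u, hu0, hu, he⟩)
  refine ⟨i.rev, i.rev.2, ?_⟩
  rw [bandFunction_of_lt ha i.rev.2, Fin.eta, Fin.rev_rev]
  exact Complex.ofReal_injective hi

/-- Conjugating a solution keeps its real energy and conjugates its multiplier, so arguments in `[0,
π]` suffice. -/
theorem floquetSpectrum_eq (ha : Function.Periodic a (q : ℤ)) (hb : Function.Periodic b (q : ℤ)) :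
    floquetSpectrum a b q
      = ⋃ i ∈ Finset.range q, bandFunction a b q ha i '' Set.Icc 0 Real.pi := by
  ext r
  simp only [Set.mem_iUnion, Finset.mem_range, exists_prop]
  constructor
  · rintro ⟨z, hz, u, hu0, hu, he⟩
    have hz' : Complex.exp (z.arg * Complex.I) = z := by
      simpa [hz] using Complex.norm_mul_exp_arg_mul_I z
    by_cases h0 : 0 ≤ z.arg
    · rw [← hz'] at hu
      obtain ⟨i, hi, h⟩ := exists_bandFunction_eq ha hb hu0 hu he
      exact ⟨i, hi, _, ⟨h0, Complex.arg_le_pi z⟩, h⟩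
    · have hu' := hu.conj
      rw [← hz', ← Complex.exp_conj, map_mul, Complex.conj_I, Complex.conj_ofReal, mul_neg,
        ← neg_mul, ← Complex.ofReal_neg] at hu'
      obtain ⟨i, hi, h⟩ := exists_bandFunction_eq (r := r) ha hb
        (fun h => hu0 (funext fun n => by simpa using congrFun h n)) hu' (by
          ext n
          rw [← conj_jacobiMap, he]
          simp)
      exact ⟨i, hi, _, ⟨by linarith, by linarith [Complex.neg_pi_lt_arg z]⟩, h⟩
  · rintro ⟨i, hi, θ, -, rfl⟩
    exact bandFunction_mem_floquetSpectrum ha hb hi θ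

/-- Two multipliers belonging to the same energy are equal or mutually inverse. On the unit circle
both cases give equal real parts, and cosine is injective on `[0, π]`. -/
theorem eq_of_bandFunction_eq (ha : Function.Periodic a (q : ℤ)) (hb : Function.Periodic b (q : ℤ))
    (ha0 : ∀ n, a n ≠ 0) {i j : ℕ} (hi : i < q) (hj : j < q) {θ η : ℝ}
    (hθ : θ ∈ Set.Icc 0 Real.pi) (hη : η ∈ Set.Icc 0 Real.pi)
    (h : bandFunction a b q ha i θ = bandFunction a b q ha j η) : θ = η := by
  obtain ⟨u, hu0, hu, hue⟩ := exists_floquet_solution ha hb hi θ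
  obtain ⟨w, hw0, hw, hwe⟩ := exists_floquet_solution ha hb hj η
  rw [← h] at hwe
  refine Real.injOn_cos hθ hη ?_
  by_cases hzz : Complex.exp (θ * Complex.I) * Complex.exp (η * Complex.I) = 1
  · rw [← Complex.exp_add] at hzz
    have h1 : Complex.exp (θ * Complex.I) = Complex.exp ((-η : ℝ) * Complex.I) := by
      have := mul_right_cancel₀ (Complex.exp_ne_zero (η * Complex.I))
        (((Complex.exp_add _ _).symm.trans hzz).trans
        (show 1 = Complex.exp ((-η : ℝ) * Complex.I) * Complex.exp (η * Complex.I) by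
          rw [← Complex.exp_add]; simp))
      exact this
    have h2 := congrArg Complex.re h1
    rwa [Complex.exp_ofReal_mul_I_re, Complex.exp_ofReal_mul_I_re, Real.cos_neg] at h2
  · have h2 := congrArg Complex.re
      (multiplier_eq_of_mul_ne_one ha ha0 hue hwe hu0 hw0 hu hw hzz)
    rwa [Complex.exp_ofReal_mul_I_re, Complex.exp_ofReal_mul_I_re] at h2

/-- For `0 < θ < π` the multiplier satisfies `z * z ≠ 1`, so solutions with this multiplier and a
given energy are proportional. Equal neighbouring eigenvalues would make two orthonormal
eigenvectors proportional. -/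
theorem bandFunction_ne_succ (ha : Function.Periodic a (q : ℤ)) (hb : Function.Periodic b (q : ℤ))
    (ha0 : ∀ n, a n ≠ 0) {i : ℕ} (hi : i + 1 < q) {θ : ℝ} (hθ : θ ∈ Set.Ioo 0 Real.pi) :
    bandFunction a b q ha i θ ≠ bandFunction a b q ha (i + 1) θ := fun h => by
  rw [bandFunction_of_lt ha hi, bandFunction_of_lt ha (by omega)] at h
  set z := Complex.exp (θ * Complex.I) with hzdef
  have hz0 : z ≠ 0 := Complex.exp_ne_zero _
  have hzz : z * z ≠ 1 := fun hzz => by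
    have h1 : z * starRingEnd ℂ z = 1 := by
      simp [Complex.mul_conj, Complex.normSq_eq_norm_sq, hzdef, Complex.norm_exp_ofReal_mul_I θ]
    have h2 := Complex.conj_eq_iff_im.1 (mul_left_cancel₀ hz0 (h1.trans hzz.symm))
    rw [hzdef, Complex.exp_ofReal_mul_I_im] at h2
    exact (Real.sin_pos_of_pos_of_lt_pi hθ.1 hθ.2).ne' h2
  have hT := isSymmetric_floquetMap (b := b) (q := q) ha (Complex.norm_exp_ofReal_mul_I θ)
  let e := hT.eigenvectorBasis finrank_euclideanSpace_fin
  have hsol : ∀ k, jacobiMap a b (floquetExtend q z (e k))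
      = (hT.eigenvalues finrank_euclideanSpace_fin k : ℂ) • floquetExtend q z (e k) := fun k => by
    rw [← floquetExtend_floquetMap ha hb hz0, ← map_smul]
    exact congrArg _ (hT.apply_eigenvectorBasis _ k)
  have hne : ∀ k, floquetExtend q z (e k) ≠ 0 := fun k h0 =>
    e.orthonormal.ne_zero k (floquetExtend_injective (h0.trans (map_zero _).symm))
  have hw := hsol (Fin.rev ⟨i + 1, hi⟩)
  rw [← h] at hw
  obtain ⟨c, hc⟩ := exists_eq_smul_of_isQuasiPeriodic ha ha0 (hsol _) hw (hne _)
    (isQuasiPeriodic_floquetExtend hz0 _) (isQuasiPeriodic_floquetExtend hz0 _) hzz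
  rw [← map_smul] at hc
  have hc' := floquetExtend_injective hc
  have horth : inner ℂ (e (Fin.rev ⟨i, by omega⟩)) (e (Fin.rev ⟨i + 1, hi⟩)) = 0 :=
    e.orthonormal.2 (by simp)
  rw [hc', inner_smul_right, inner_self_eq_norm_sq_to_K, e.orthonormal.1] at horth
  have hc0 : c = 0 := by simpa using horth
  rw [hc0, zero_smul] at hc'
  exact e.orthonormal.ne_zero _ hc'

end

/-! ### From band functions to bands -/

/-- Images of the interval are intervals, nondegenerate by injectivity. If two neighbouring ones
overlapped, a level `m` strictly inside the overlap would be attained by both functions between the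
maximum point `s` of the lower and the minimum point `t` of the upper function. By `hinj` it is
attained at one common point; that point differs from `s` and `t`, so it is interior and contradicts
`hne`. -/
theorem exists_bands {p : ℕ} {f : ℕ → ℝ → ℝ} {c d : ℝ} (hcd : c < d)
    (hf : ∀ i < p, Continuous (f i)) (hmono : ∀ i, i + 1 < p → ∀ θ, f i θ ≤ f (i + 1) θ)
    (hinj : ∀ i < p, ∀ j < p, ∀ θ ∈ Set.Icc c d, ∀ η ∈ Set.Icc c d, f i θ = f j η → θ = η)
    (hne : ∀ i, i + 1 < p → ∀ θ ∈ Set.Ioo c d, f i θ ≠ f (i + 1) θ) :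
    ∃ lo hi : ℕ → ℝ, (∀ i < p, lo i < hi i) ∧ (∀ i, i + 1 < p → hi i ≤ lo (i + 1)) ∧
      ∀ i < p, f i '' Set.Icc c d = Set.Icc (lo i) (hi i) := by
  have hIcc : ∀ i < p, f i '' Set.Icc c d
      = Set.Icc (sInf (f i '' Set.Icc c d)) (sSup (f i '' Set.Icc c d)) := fun i hi =>
    (hf i hi).continuousOn.image_Icc hcd.le
  set lo := fun i => sInf (f i '' Set.Icc c d)
  set hi := fun i => sSup (f i '' Set.Icc c d)
  have hlt : ∀ i < p, lo i < hi i := fun i h => by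
    have h1 : f i c ∈ Set.Icc (lo i) (hi i) := hIcc i h ▸ ⟨c, ⟨le_rfl, hcd.le⟩, rfl⟩
    have h2 : f i d ∈ Set.Icc (lo i) (hi i) := hIcc i h ▸ ⟨d, ⟨hcd.le, le_rfl⟩, rfl⟩
    refine lt_of_not_ge fun hle => hcd.ne ?_
    exact hinj i h i h c ⟨le_rfl, hcd.le⟩ d ⟨hcd.le, le_rfl⟩
      (le_antisymm (h1.2.trans (hle.trans h2.1)) (h2.2.trans (hle.trans h1.1)))
  refine ⟨lo, hi, hlt, fun i h => le_of_not_gt fun hover => ?_, hIcc⟩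
  have h' : i < p := by omega
  obtain ⟨s, hs, hs'⟩ : hi i ∈ f i '' Set.Icc c d := by
    rw [hIcc i h']; exact ⟨(hlt i h').le, le_rfl⟩
  obtain ⟨t, ht, ht'⟩ : lo (i + 1) ∈ f (i + 1) '' Set.Icc c d := by
    rw [hIcc _ h]; exact ⟨le_rfl, (hlt _ h).le⟩
  obtain ⟨m, hm1, hm2⟩ := exists_between hover
  have h1 := hmono i h s
  have h2 := hmono i h t
  have hsub := Set.uIcc_subset_Icc hs ht
  obtain ⟨θ, hθ, hθm⟩ := intermediate_value_uIcc (hf i h').continuousOn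
    (show m ∈ Set.uIcc (f i s) (f i t) from Set.mem_uIcc.2 (Or.inr ⟨by linarith, by linarith⟩))
  obtain ⟨η, hη, hηm⟩ := intermediate_value_uIcc (hf _ h).continuousOn
    (show m ∈ Set.uIcc (f (i + 1) s) (f (i + 1) t) from
      Set.mem_uIcc.2 (Or.inr ⟨by linarith, by linarith⟩))
  obtain rfl := hinj i h' _ h θ (hsub hθ) η (hsub hη) (hθm.trans hηm.symm)
  have hθs : θ ≠ s := by rintro rfl; linarith
  have hθt : θ ≠ t := by rintro rfl; linarith
  refine hne i h θ ?_ (hθm.trans hηm.symm)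
  rcases Set.mem_uIcc.1 hθ with hθ | hθ
  · exact ⟨hs.1.trans_lt (lt_of_le_of_ne hθ.1 hθs.symm), (lt_of_le_of_ne hθ.2 hθt).trans_le ht.2⟩
  · exact ⟨ht.1.trans_lt (lt_of_le_of_ne hθ.1 hθt.symm), (lt_of_le_of_ne hθ.2 hθs).trans_le hs.2⟩

theorem exists_bands_floquetSpectrum {a b : ℤ → ℝ} {q : ℕ} [NeZero q]
    (ha : Function.Periodic a (q : ℤ)) (hb : Function.Periodic b (q : ℤ)) (ha0 : ∀ n, a n ≠ 0) :
    ∃ lo hi : ℕ → ℝ, (∀ i < q, lo i < hi i) ∧ (∀ i, i + 1 < q → hi i ≤ lo (i + 1)) ∧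
      floquetSpectrum a b q = ⋃ i ∈ Finset.range q, Set.Icc (lo i) (hi i) := by
  obtain ⟨lo, hi, h1, h2, h3⟩ := exists_bands (f := bandFunction a b q ha) Real.pi_pos
    (fun i hi => continuous_bandFunction ha hi) (fun i hi => bandFunction_le_succ ha hi)
    (fun i hi j hj θ hθ η hη => eq_of_bandFunction_eq ha hb ha0 hi hj hθ hη)
    (fun i hi θ hθ => bandFunction_ne_succ ha hb ha0 hi hθ)
  refine ⟨lo, hi, h1, h2, ?_⟩
  rw [floquetSpectrum_eq ha hb]
  exact Set.iUnion₂_congr fun i hi => h3 i (Finset.mem_range.1 hi)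

theorem isClosed_floquetSpectrum {a b : ℤ → ℝ} {q : ℕ} [NeZero q]
    (ha : Function.Periodic a (q : ℤ)) (hb : Function.Periodic b (q : ℤ)) :
    IsClosed (floquetSpectrum a b q) := by
  rw [floquetSpectrum_eq ha hb]
  refine Set.Finite.isClosed_biUnion (Finset.finite_toSet _) fun i hi => ?_
  exact (isCompact_Icc.image
    (continuous_bandFunction ha (Finset.mem_range.1 (Finset.mem_coe.1 hi)))).isClosed


/-! ### The spectrum on `ℓ²(ℤ)` equals the Floquet spectrum -/

/-- Being bounded below gives injectivity and closed range; for a self-adjoint operator the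
orthogonal complement of the range is the kernel, so the range is also dense. -/
theorem isUnit_iff_exists_mul_norm_le {E : Type*} [NormedAddCommGroup E] [InnerProductSpace ℂ E]
    [CompleteSpace E] {f : E →L[ℂ] E} (hf : IsSelfAdjoint f) :
    IsUnit f ↔ ∃ c > 0, ∀ x, c * ‖x‖ ≤ ‖f x‖ := by
  rw [ContinuousLinearMap.isUnit_iff_bijective,
    ContinuousLinearMap.bijective_iff_dense_range_and_antilipschitz,
    ← antilipschitzWith_iff_exists_mul_le_norm, and_iff_right_iff_imp]
  rintro ⟨c, hc⟩
  rw [Submodule.topologicalClosure_eq_top_iff, ContinuousLinearMap.orthogonal_range,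
    ContinuousLinearMap.isSelfAdjoint_iff'.1 hf]
  exact LinearMap.ker_eq_bot.2 hc.injective

theorem ellTwo_norm_sq (y : EllTwo) : ‖y‖ ^ 2 = ∑' n, ‖y n‖ ^ 2 := by
  have := lp.norm_rpow_eq_tsum (p := 2) (by norm_num) y
  simpa using this

theorem ellTwo_summable_norm_sq (y : EllTwo) : Summable fun n => ‖y n‖ ^ 2 := by
  have := (lp.memℓp y).summable (by norm_num)
  simpa using this

theorem sum_norm_sq_le (y : EllTwo) (s : Finset ℤ) : ∑ n ∈ s, ‖y n‖ ^ 2 ≤ ‖y‖ ^ 2 := by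
  rw [ellTwo_norm_sq]
  exact (ellTwo_summable_norm_sq y).sum_le_tsum s fun _ _ => by positivity

theorem sum_norm_sq_eq {y : EllTwo} {s : Finset ℤ} (h : ∀ n ∉ s, y n = 0) :
    ∑ n ∈ s, ‖y n‖ ^ 2 = ‖y‖ ^ 2 := by
  rw [ellTwo_norm_sq, tsum_eq_sum fun n hn => by simp [h n hn]]

theorem inner_weightedShift_left {c : ℤ → ℝ} (hc : IsBddSeq c) (e : ℤ ≃ ℤ) {c' : ℤ → ℝ}
    (hc' : IsBddSeq c') (h : ∀ n, c' n = c (e.symm n)) (x y : EllTwo) :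
    inner ℂ (weightedShift c hc e x) y = inner ℂ x (weightedShift c' hc' e.symm y) := by
  rw [lp.inner_eq_tsum, lp.inner_eq_tsum,
    ← e.tsum_eq fun n => inner ℂ (x n) (weightedShift c' hc' e.symm y n)]
  refine tsum_congr fun n => ?_
  change inner ℂ ((c n : ℂ) * x (e n)) (y n) = inner ℂ (x (e n)) ((c' (e n) : ℂ) * y (e.symm (e n)))
  rw [h, e.symm_apply_apply]
  simp
  ring

theorem isSelfAdjoint_jacobiOperator (a b : ℤ → ℝ) (ha : IsBddSeq a) (hb : IsBddSeq b) :
    IsSelfAdjoint (jacobiOperator a b ha hb) := by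
  rw [ContinuousLinearMap.isSelfAdjoint_iff_isSymmetric]
  intro x y
  change inner ℂ (weightedShift _ _ _ x + weightedShift _ _ _ x + weightedShift _ _ _ x) y
    = inner ℂ x (weightedShift _ _ _ y + weightedShift _ _ _ y + weightedShift _ _ _ y)
  rw [inner_add_left, inner_add_left, inner_add_right, inner_add_right,
    inner_weightedShift_left _ _ ha (by intro n; simp),
    inner_weightedShift_left _ _ hb (by intro n; simp),
    inner_weightedShift_left _ _ (ha.comp (fun n => n - 1)) (by intro n; simp [sub_eq_add_neg])]
  have h1 : (Equiv.subRight (1 : ℤ)).symm = Equiv.addRight 1 := by ext; simp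
  have h2 : (Equiv.addRight (1 : ℤ)).symm = Equiv.subRight 1 := by ext; simp [sub_eq_add_neg]
  rw [h1, h2, Equiv.refl_symm]
  ring

theorem IsQuasiPeriodic.apply_add_nat_mul {p : ℕ} {z : ℂ} {u : ℤ → ℂ} (hu : IsQuasiPeriodic p z u)
    (N : ℕ) (n : ℤ) : u (n + (N * p : ℕ)) = z ^ N * u n := by
  induction N with
  | zero => simp
  | succ N ih =>
    rw [show n + ((N + 1) * p : ℕ) = n + (N * p : ℕ) + p by push_cast; ring, hu, ih, pow_succ]
    ring

/-- Translation by `p` acts on the finite-dimensional nonzero space `V` of solutions with energy `r`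
and multiplier `z` over `N * p`. An eigenvector of this action has a multiplier `ζ` over `p` with `ζ
^ N = z`, hence of modulus one. -/
theorem floquetSpectrum_mul_subset {a b : ℤ → ℝ} {p N : ℕ} (hp : p ≠ 0) (hN : N ≠ 0)
    (ha : Function.Periodic a (p : ℤ)) (hb : Function.Periodic b (p : ℤ)) :
    floquetSpectrum a b (N * p) ⊆ floquetSpectrum a b p := by
  rintro r ⟨z, hz, u, hu0, hu, he⟩
  have hz0 : z ≠ 0 := norm_ne_zero_iff.1 (by simp [hz])
  have : NeZero (N * p) := ⟨mul_ne_zero hN hp⟩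
  let V : Submodule ℂ (ℤ → ℂ) :=
    { carrier := {u | IsQuasiPeriodic (N * p) z u ∧ jacobiMap a b u = (r : ℂ) • u}
      add_mem' := fun {x y} hx hy =>
        ⟨fun n => by rw [Pi.add_apply, Pi.add_apply, hx.1, hy.1, mul_add],
          by rw [map_add, hx.2, hy.2, smul_add]⟩
      zero_mem' := ⟨fun n => by simp, by simp⟩
      smul_mem' := fun c x hx =>
        ⟨fun n => by rw [Pi.smul_apply, Pi.smul_apply, hx.1, smul_eq_mul, smul_eq_mul]; ring,
          by rw [map_smul, hx.2, smul_comm]⟩ }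
  have hV : ∀ {x}, x ∈ V ↔ IsQuasiPeriodic (N * p) z x ∧ jacobiMap a b x = (r : ℂ) • x := Iff.rfl
  let S : (ℤ → ℂ) →ₗ[ℂ] (ℤ → ℂ) := LinearMap.funLeft ℂ ℂ fun n => n + (p : ℤ)
  have hS : ∀ x n, S x n = x (n + p) := fun _ _ => rfl
  have hSV : ∀ x ∈ V, S x ∈ V := fun x hx => by
    refine hV.2 ⟨fun n => ?_, ?_⟩
    · rw [hS, hS, add_right_comm, (hV.1 hx).1]
    · ext n
      have := congrFun (hV.1 hx).2 (n + p)
      rw [jacobiMap_apply, ha, hb, show n + (p : ℤ) - 1 = n - 1 + p by ring, ha,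
        show n + (p : ℤ) + 1 = n + 1 + p by ring] at this
      exact this
  have : FiniteDimensional ℂ V := by
    refine FiniteDimensional.of_injective (floquetRestrict (N * p) ∘ₗ V.subtype) fun x y hxy => ?_
    refine Subtype.ext ?_
    rw [← floquetExtend_floquetRestrict hz0 (hV.1 x.2).1,
      ← floquetExtend_floquetRestrict hz0 (hV.1 y.2).1]
    exact congrArg _ hxy
  have : Nontrivial V :=
    ⟨⟨⟨u, hV.2 ⟨hu, he⟩⟩, 0, fun h => hu0 (congrArg Subtype.val h)⟩⟩
  obtain ⟨ζ, hζ⟩ := Module.End.exists_eigenvalue (S.restrict hSV)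
  obtain ⟨w, hw⟩ := hζ.exists_hasEigenvector
  have hwq : IsQuasiPeriodic p ζ w := fun n =>
    congrFun (congrArg Subtype.val hw.apply_eq_smul) n
  have hw0 : (w : ℤ → ℂ) ≠ 0 := fun h => hw.2 (Subtype.ext h)
  refine ⟨ζ, ?_, w, hw0, hwq, (hV.1 w.2).2⟩
  obtain ⟨n, hn⟩ := Function.ne_iff.1 hw0
  have h1 := hwq.apply_add_nat_mul N n
  rw [(hV.1 w.2).1 n] at h1
  have h2 := mul_right_cancel₀ hn h1
  rw [← pow_eq_one_iff_of_nonneg (norm_nonneg ζ) hN, ← norm_pow, ← h2, hz]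

/-- A finitely supported `y` can be wrapped onto a long circle without changing the action of the
operator. There it becomes a vector of a Floquet matrix with multiplier `1`, whose eigenvalues lie
in the Floquet spectrum of period `p`. Density of finitely supported vectors gives the general case.
-/
theorem mul_norm_le_of_le_abs_sub {a b : ℤ → ℝ} {p : ℕ} (hp : p ≠ 0)
    (ha : Function.Periodic a (p : ℤ)) (hb : Function.Periodic b (p : ℤ)) (ha' : IsBddSeq a)
    (hb' : IsBddSeq b) {r d : ℝ} (hd : 0 ≤ d) (h : ∀ s ∈ floquetSpectrum a b p, d ≤ |s - r|)
    (y : EllTwo) : d * ‖y‖ ≤ ‖jacobiOperator a b ha' hb' y - (r : ℂ) • y‖ := by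
  have hfin : ∀ (s : Finset ℤ) (y : EllTwo), (∀ n ∉ s, y n = 0) →
      d * ‖y‖ ≤ ‖jacobiOperator a b ha' hb' y - (r : ℂ) • y‖ := by
    intro s y hy
    obtain ⟨M, hM⟩ : ∃ M : ℕ, ∀ n : ℤ, M < n.natAbs → y n = 0 :=
      ⟨∑ n ∈ s, n.natAbs, fun n hn => hy n fun hns => hn.not_ge
        (Finset.single_le_sum (f := fun n : ℤ => n.natAbs) (fun _ _ => Nat.zero_le _) hns)⟩
    -- The circle has length `q = 2 * t`, with the support centred at `t`. The margin `M + 2 ≤ t`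
    -- makes `y` vanish at `-t - 1`, `-t`, `t - 1` and `t`, so wrapping creates no interaction
    -- across the cut.
    obtain ⟨q, hq⟩ : ∃ q, q = (2 * (M + 2)) * p := ⟨_, rfl⟩
    obtain ⟨t, ht⟩ : ∃ t, t = (M + 2) * p := ⟨_, rfl⟩
    have : NeZero q := ⟨by rw [hq]; positivity⟩
    have hqt : q = 2 * t := by rw [hq, ht]; ring
    have hMt : M + 2 ≤ t := ht ▸ Nat.le_mul_of_pos_right _ (Nat.pos_of_ne_zero hp)
    have haq : Function.Periodic a (q : ℤ) := by
      rw [hq, Nat.cast_mul]; exact ha.nat_mul _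
    have hbq : Function.Periodic b (q : ℤ) := by
      rw [hq, Nat.cast_mul]; exact hb.nat_mul _
    have hat : Function.Periodic a (t : ℤ) := by
      rw [ht, Nat.cast_mul]; exact ha.nat_mul _
    have hbt : Function.Periodic b (t : ℤ) := by
      rw [ht, Nat.cast_mul]; exact hb.nat_mul _
    have hT := isSymmetric_floquetMap (b := b) (z := 1) haq norm_one
    let v : EuclideanSpace ℂ (Fin q) := floquetRestrict q fun k => y (k - t)
    have hv : ∀ k : ℤ, -1 ≤ k → k ≤ q → floquetExtend q 1 v k = y (k - t) := by
      have hmid : ∀ k : ℤ, 0 ≤ k → k < q → floquetExtend q 1 v k = y (k - t) := fun k h0 h1 => by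
        obtain ⟨k, rfl⟩ := Int.eq_ofNat_of_zero_le h0
        rw [floquetExtend_natCast v (by omega)]
        rfl
      have hper := isQuasiPeriodic_floquetExtend one_ne_zero v
      intro k h0 h1
      rcases eq_or_lt_of_le h0 with h0 | h0
      · have := hper k
        rw [one_mul] at this
        rw [← this, hmid _ (by omega) (by omega), hM _ (by omega), hM _ (by omega)]
      rcases eq_or_lt_of_le h1 with h1 | h1
      · have := hper 0
        rw [one_mul, zero_add] at this
        rw [h1, this, hmid _ (by omega) (by omega), hM _ (by omega), hM _ (by omega)]
      · exact hmid k (by omega) h1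
    have hTv : ∀ k : Fin q, (floquetMap a b q 1 v - (r : ℂ) • v) k
        = (jacobiOperator a b ha' hb' y - (r : ℂ) • y) ((k : ℕ) - t) := fun k => by
      have hk := k.2
      change floquetMap a b q 1 v k - (r : ℂ) * y ((k : ℕ) - t)
        = jacobiMap a b y ((k : ℕ) - t) - (r : ℂ) * y ((k : ℕ) - t)
      rw [floquetMap_apply, jacobiMap_apply, jacobiMap_apply, hv _ (by omega) (by omega),
        hv _ (by omega) (by omega), hv _ (by omega) (by omega), hat.sub_eq, hbt.sub_eq,
        show ((k : ℕ) : ℤ) - t - 1 = (k : ℕ) - 1 - t by ring, hat.sub_eq,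
        show ((k : ℕ) : ℤ) - t + 1 = (k : ℕ) + 1 - t by ring]
    let ι : ℕ ↪ ℤ := ⟨fun k => (k : ℤ) - t, fun i j hij => by simpa using hij⟩
    have hnorm : ∀ (w : EuclideanSpace ℂ (Fin q)) (x : EllTwo),
        (∀ k : Fin q, w k = x ((k : ℕ) - t)) →
        ‖w‖ ^ 2 = ∑ n ∈ (Finset.range q).map ι, ‖x n‖ ^ 2 := fun w x hwx => by
      rw [EuclideanSpace.norm_sq_eq, Finset.sum_map,
        ← Fin.sum_univ_eq_sum_range fun k => ‖x (ι k)‖ ^ 2]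
      exact Finset.sum_congr rfl fun k _ => by rw [hwx]; rfl
    have hvy : ‖v‖ = ‖y‖ := by
      rw [← sq_eq_sq₀ (norm_nonneg _) (norm_nonneg _), hnorm v y fun k => rfl]
      refine sum_norm_sq_eq fun n hn => hM n (not_le.1 fun hle => hn ?_)
      rw [Finset.mem_map]
      refine ⟨(n + t).toNat, Finset.mem_range.2 (by omega), ?_⟩
      change (((n + t).toNat : ℕ) : ℤ) - t = n
      omega
    rw [← hvy]
    refine (hT.mul_norm_le_norm_sub_of_le_abs_sub finrank_euclideanSpace_fin hd (fun i => h _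
      (floquetSpectrum_mul_subset hp (N := 2 * (M + 2)) (by omega) ha hb ⟨1, norm_one, ?_⟩)) v).trans ?_
    · rw [← hq]
      exact (hasEigenvalue_floquetMap_iff haq hbq one_ne_zero).1 (hT.hasEigenvalue_eigenvalues _ i)
    · refine le_of_sq_le_sq ?_ (norm_nonneg _)
      have := hnorm _ _ hTv
      exact this.le.trans (sum_norm_sq_le _ _)
  have hlim := lp.hasSum_single (p := 2) (by norm_num) y
  have hJ : Continuous fun y => ‖jacobiOperator a b ha' hb' y - (r : ℂ) • y‖ := by fun_prop
  have hd' : Continuous fun y : EllTwo => d * ‖y‖ := by fun_prop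
  refine le_of_tendsto_of_tendsto' ((hd'.tendsto y).comp hlim) ((hJ.tendsto y).comp hlim)
    fun s => hfin s _ fun n hn => ?_
  rw [lp.coeFn_sum, Finset.sum_apply]
  refine Finset.sum_eq_zero fun i hi => lp.single_apply_ne _ _ _ ?_
  rintro rfl
  exact hn hi

theorem ofReal_mem_spectrum_iff {a b : ℤ → ℝ} (ha : IsBddSeq a) (hb : IsBddSeq b) (r : ℝ) :
    (r : ℂ) ∈ spectrum ℂ (jacobiOperator a b ha hb) ↔
      ¬ ∃ c > 0, ∀ y, c * ‖y‖ ≤ ‖jacobiOperator a b ha hb y - (r : ℂ) • y‖ := by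
  rw [spectrum.mem_iff, not_iff_not, ← IsUnit.neg_iff, neg_sub, isUnit_iff_exists_mul_norm_le]
  · rfl
  · refine (isSelfAdjoint_jacobiOperator a b ha hb).sub ?_
    rw [Algebra.algebraMap_eq_smul_one]
    exact IsSelfAdjoint.smul (Complex.conj_ofReal r) (IsSelfAdjoint.one _)

theorem IsQuasiPeriodic.isBddSeq {p : ℕ} (hp : 0 < p) {z : ℂ} (hz : ‖z‖ = 1) {u : ℤ → ℂ}
    (hu : IsQuasiPeriodic p z u) : IsBddSeq fun n => ‖u n‖ :=
  isBddSeq_of_periodic hp fun n => by rw [hu, norm_mul, hz, one_mul]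

theorem IsQuasiPeriodic.sum_norm_sq {p : ℕ} {z : ℂ} (hz : ‖z‖ = 1) {u : ℤ → ℂ}
    (hu : IsQuasiPeriodic p z u) (N : ℕ) :
    ∑ k ∈ Finset.range (N * p), ‖u k‖ ^ 2 = N * ∑ k ∈ Finset.range p, ‖u k‖ ^ 2 := by
  induction N with
  | zero => simp
  | succ N ih =>
    rw [Nat.succ_mul, Finset.sum_range_add, ih, Nat.cast_succ, add_mul, one_mul]
    congr 1
    refine Finset.sum_congr rfl fun k _ => ?_
    rw [add_comm, Nat.cast_add, hu.apply_add_nat_mul, norm_mul, norm_pow, hz, one_pow, one_mul]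

theorem IsQuasiPeriodic.sum_norm_sq_pos {p : ℕ} [NeZero p] {z : ℂ} (hz : ‖z‖ = 1) {u : ℤ → ℂ}
    (hu : IsQuasiPeriodic p z u) (hu0 : u ≠ 0) : 0 < ∑ k ∈ Finset.range p, ‖u k‖ ^ 2 := by
  have hz0 : z ≠ 0 := norm_ne_zero_iff.1 (by simp [hz])
  rw [← Fin.sum_univ_eq_sum_range fun k => ‖u k‖ ^ 2]
  have : floquetRestrict p u ≠ 0 := fun h =>
    hu0 (by rw [← floquetExtend_floquetRestrict hz0 hu, h, map_zero])
  have h2 := EuclideanSpace.norm_sq_eq (floquetRestrict p u)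
  simp only [floquetRestrict_apply] at h2
  rw [← h2]
  positivity

/-- Weyl sequence argument: truncating a Floquet solution to `N` periods gives squared norm
proportional to `N`, while the defect in the eigenvalue equation lives at the two cuts and stays
bounded. -/
theorem floquetSpectrum_subset_spectrum {a b : ℤ → ℝ} {p : ℕ} [NeZero p] (ha : IsBddSeq a)
    (hb : IsBddSeq b) {r : ℝ} (hr : r ∈ floquetSpectrum a b p) :
    (r : ℂ) ∈ spectrum ℂ (jacobiOperator a b ha hb) := by
  obtain ⟨z, hz, u, hu0, hu, he⟩ := hr
  rw [ofReal_mem_spectrum_iff]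
  rintro ⟨c, hc, h⟩
  have hp := Nat.pos_of_ne_zero (NeZero.ne p)
  obtain ⟨A, hA⟩ := id ha
  obtain ⟨B, hB⟩ := id hb
  obtain ⟨U, hU⟩ := hu.isBddSeq hp hz
  simp only [abs_norm] at hU
  have hA0 : 0 ≤ A := (abs_nonneg _).trans (hA 0)
  have hB0 : 0 ≤ B := (abs_nonneg _).trans (hB 0)
  have hU0 : 0 ≤ U := (norm_nonneg _).trans (hU 0)
  set K := A * U + B * U + A * U + |r| * U
  set m := ∑ k ∈ Finset.range p, ‖u k‖ ^ 2
  have hm : 0 < m := hu.sum_norm_sq_pos hz hu0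
  -- This makes `c ^ 2 * (N * m)` exceed `4 * K ^ 2`, where `K` bounds each entry of the defect and
  -- at most four entries are nonzero.
  obtain ⟨N, hN⟩ := exists_nat_gt (4 * K ^ 2 / (c ^ 2 * m))
  rw [div_lt_iff₀ (by positivity)] at hN
  let s : Finset ℤ := (Finset.range (N * p)).map Nat.castEmbedding
  have hs : ∀ n : ℤ, n ∈ s ↔ 0 ≤ n ∧ n < (N * p : ℕ) := fun n => by
    simp only [s, Finset.mem_map, Finset.mem_range, Nat.castEmbedding_apply]
    constructor
    · rintro ⟨k, hk, rfl⟩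
      omega
    · rintro ⟨h0, h1⟩
      exact ⟨n.toNat, by omega, by omega⟩
  let y : EllTwo := ∑ n ∈ s, lp.single 2 n (u n)
  have hy : ∀ n, y n = if 0 ≤ n ∧ n < (N * p : ℕ) then u n else 0 := fun n => by
    change (∑ n ∈ s, lp.single 2 n (u n) : EllTwo) n = _
    rw [lp.coeFn_sum, Finset.sum_apply]
    simp only [lp.single_apply, Finset.sum_pi_single, hs]
  have hyU : ∀ n, ‖y n‖ ≤ U := fun n => by
    rw [hy]
    split_ifs
    · exact hU n
    · simpa using hU0
  have hynorm : ‖y‖ ^ 2 = N * m := by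
    rw [← sum_norm_sq_eq (s := s) fun n hn => by rw [hy, if_neg (by rwa [← hs])],
      ← hu.sum_norm_sq hz N, Finset.sum_map]
    refine Finset.sum_congr rfl fun k hk => ?_
    rw [hy, if_pos (by rw [← hs]; exact Finset.mem_map_of_mem _ hk)]
    rfl
  set f := jacobiOperator a b ha hb y - (r : ℂ) • y
  have hf : ∀ n, f n = (a (n - 1) : ℂ) * y (n - 1) + (b n : ℂ) * y n + (a n : ℂ) * y (n + 1)
      - (r : ℂ) * y n := fun n => rfl
  have hfK : ∀ n, ‖f n‖ ≤ K := fun n => by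
    rw [hf]
    refine (norm_sub_le _ _).trans (add_le_add ((norm_add₃_le).trans ?_) ?_)
    · simp only [norm_mul, Complex.norm_real, Real.norm_eq_abs]
      gcongr
      exacts [hA _, hyU _, hB _, hyU _, hA _, hyU _]
    · simp only [norm_mul, Complex.norm_real, Real.norm_eq_abs]
      gcongr
      exact hyU _
  have hfs : ∀ n ∉ ({-1, 0, ((N * p : ℕ) : ℤ) - 1, ((N * p : ℕ) : ℤ)} : Finset ℤ), f n = 0 := by
    intro n hn
    simp only [Finset.mem_insert, Finset.mem_singleton, not_or] at hn
    obtain ⟨h1, h2, h3, h4⟩ := hn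
    have hen := congrFun he n
    rw [jacobiMap_apply, Pi.smul_apply, smul_eq_mul] at hen
    rw [hf, hy, hy, hy]
    by_cases hcase : 0 ≤ n ∧ n < (N * p : ℕ)
    · rw [if_pos (by omega), if_pos hcase, if_pos (by omega), hen, sub_self]
    · rw [if_neg (by omega), if_neg hcase, if_neg (by omega)]
      simp
  have hfn : ‖f‖ ^ 2 ≤ 4 * K ^ 2 := by
    rw [← sum_norm_sq_eq hfs]
    refine (Finset.sum_le_card_nsmul _ _ (K ^ 2) fun n _ => ?_).trans ?_
    · gcongr
      exact hfK n
    · rw [nsmul_eq_mul]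
      gcongr
      exact_mod_cast Finset.card_le_four
  have hfinal : (c * ‖y‖) ^ 2 ≤ ‖f‖ ^ 2 := by
    gcongr
    exact h y
  rw [mul_pow, hynorm] at hfinal
  linarith

/-- Self-adjointness makes spectral points real. A real point off the closed Floquet spectrum has
positive distance `d` from it, and `d` is then a lower bound for the shifted operator. -/
theorem spectrum_jacobiOperator {a b : ℤ → ℝ} {p : ℕ} [NeZero p] (ha : Function.Periodic a (p : ℤ))
    (hb : Function.Periodic b (p : ℤ)) (ha' : IsBddSeq a) (hb' : IsBddSeq b) :
    spectrum ℂ (jacobiOperator a b ha' hb') = Complex.ofReal '' floquetSpectrum a b p := by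
  refine Set.Subset.antisymm (fun l hl => ?_) ?_
  · have hre := (isSelfAdjoint_jacobiOperator a b ha' hb').mem_spectrum_eq_re hl
    refine ⟨l.re, by_contra fun hn => ?_, hre.symm⟩
    rw [hre, ofReal_mem_spectrum_iff] at hl
    obtain ⟨d, hd, hball⟩ := Metric.isOpen_iff.1
      (isClosed_floquetSpectrum ha hb).isOpen_compl l.re hn
    refine hl ⟨d, hd, mul_norm_le_of_le_abs_sub (NeZero.ne p) ha hb ha' hb' hd.le fun s hs => ?_⟩
    refine not_lt.1 fun hlt => hball (Metric.mem_ball.2 ?_) hs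
    rwa [Real.dist_eq]
  · rintro _ ⟨r, hr, rfl⟩
    exact floquetSpectrum_subset_spectrum ha' hb' hr


/-! ### Measure of the spectrum -/

/-- Translation brings an arbitrary coefficient `a n` into the corner position `-1`. -/
theorem floquetSpectrum_subset_shift (a b : ℤ → ℝ) (p : ℕ) (s : ℤ) :
    floquetSpectrum a b p ⊆ floquetSpectrum (fun n => a (n + s)) (fun n => b (n + s)) p := by
  rintro r ⟨z, hz, u, hu0, hu, he⟩
  refine ⟨z, hz, fun n => u (n + s), fun h => hu0 (funext fun n => ?_), fun n => ?_, ?_⟩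
  · simpa using congrFun h (n - s)
  · change u (n + p + s) = z * u (n + s)
    rw [add_right_comm, hu]
  · ext n
    have := congrFun he (n + s)
    rw [jacobiMap_apply, add_right_comm n s 1, add_sub_right_comm n s 1] at this
    exact this

theorem re_inner_rankOne_self {E : Type*} [NormedAddCommGroup E] [InnerProductSpace ℂ E] (x v : E) :
    RCLike.re (inner ℂ v (InnerProductSpace.rankOne ℂ x x v)) = ‖inner ℂ x v‖ ^ 2 := by
  rw [InnerProductSpace.rankOne_apply, inner_smul_right, inner_mul_symm_re_eq_norm, norm_mul,
    norm_inner_symm v x, sq]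

theorem two_mul_abs_re_mul_le {z x y : ℂ} (hz : ‖z‖ = 1) :
    2 * |(z * (x * starRingEnd ℂ y)).re| ≤ ‖x‖ ^ 2 + ‖y‖ ^ 2 := by
  have h := Complex.abs_re_le_norm (z * (x * starRingEnd ℂ y))
  rw [norm_mul, norm_mul, hz, RCLike.norm_conj, one_mul] at h
  nlinarith [sq_nonneg (‖x‖ - ‖y‖)]

theorem norm_add_sq_eq (x y : ℂ) :
    ‖x + y‖ ^ 2 = ‖x‖ ^ 2 + ‖y‖ ^ 2 + 2 * (x * starRingEnd ℂ y).re := by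
  simp only [← Complex.normSq_eq_norm_sq, Complex.normSq_add]

/-- Since `2 * |Re (z * v 0 * conj (v last))| ≤ ‖v 0‖ ^ 2 + ‖v last‖ ^ 2`, changing the multiplier
from `1` to `z` raises the form by at most `a (-1) * ‖v 0 - v last‖ ^ 2` and lowers it by at most `a
(-1) * ‖v 0 + v last‖ ^ 2`. Both bounds are rank-one forms independent of `z`, so Weyl monotonicity
confines the `i`-th eigenvalue to a fixed interval for all `z`. The lengths add up to the difference
of traces, `2 * a (-1)` from each form. -/
theorem exists_intervals_floquetSpectrum_subset {a b : ℤ → ℝ} {q : ℕ} (hq : 2 ≤ q)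
    (ha : Function.Periodic a (q : ℤ)) (hb : Function.Periodic b (q : ℤ)) (ha0 : 0 ≤ a (-1)) :
    ∃ lo hi : Fin q → ℝ, (∀ i, lo i ≤ hi i) ∧ ∑ i, (hi i - lo i) = 4 * a (-1) ∧
      floquetSpectrum a b q ⊆ ⋃ i, Set.Icc (lo i) (hi i) := by
  have : NeZero q := ⟨by omega⟩
  -- The two corner sites are distinct because `2 ≤ q`; this is what gives `x` and `y` squared norm
  -- `2`.
  have h0l : (0 : Fin q) ≠ Fin.rev 0 := fun h => by
    have := congrArg Fin.val h
    simp at this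
    omega
  let T := floquetMap a b q 1
  have hT : T.IsSymmetric := isSymmetric_floquetMap ha norm_one
  let x : EuclideanSpace ℂ (Fin q) :=
    EuclideanSpace.single 0 1 + (-1 : ℂ) • EuclideanSpace.single (Fin.rev 0) 1
  let y : EuclideanSpace ℂ (Fin q) :=
    EuclideanSpace.single 0 1 + EuclideanSpace.single (Fin.rev 0) 1
  have hx : ∀ v, inner ℂ x v = v 0 + -v (Fin.rev 0) := fun v => by
    simp [x, EuclideanSpace.inner_single_left]
  have hy : ∀ v, inner ℂ y v = v 0 + v (Fin.rev 0) := fun v => by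
    simp [y, EuclideanSpace.inner_single_left]
  let R : EuclideanSpace ℂ (Fin q) → EuclideanSpace ℂ (Fin q) →ₗ[ℂ] EuclideanSpace ℂ (Fin q) :=
    fun x => (InnerProductSpace.rankOne ℂ x x).toLinearMap
  have hR : ∀ x, (R x).IsSymmetric := InnerProductSpace.isSymmetric_rankOne_self
  have hRre : ∀ x v, RCLike.re (inner ℂ v (R x v)) = ‖inner ℂ x v‖ ^ 2 := re_inner_rankOne_self
  let c : ℂ := (a (-1) : ℂ)
  have hcR : ∀ x, (c • R x).IsSymmetric := fun x => (hR x).smul (Complex.conj_ofReal _)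
  have hre : ∀ x v, RCLike.re (inner ℂ v ((c • R x) v)) = a (-1) * ‖inner ℂ x v‖ ^ 2 :=
    fun x v => by
    rw [LinearMap.smul_apply, inner_smul_right, ← hRre]
    exact RCLike.re_ofReal_mul _ _
  have hhi : (T + c • R x).IsSymmetric := hT.add (hcR x)
  have hlo : (T - c • R y).IsSymmetric := hT.sub (hcR y)
  have hn : Module.finrank ℂ (EuclideanSpace ℂ (Fin q)) = q := finrank_euclideanSpace_fin
  have hup : ∀ z : ℂ, ‖z‖ = 1 → ∀ v, RCLike.re (inner ℂ v (floquetMap a b q z v))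
      ≤ RCLike.re (inner ℂ v ((T + c • R x) v)) + 0 * ‖v‖ ^ 2 := fun z hz v => by
    rw [re_inner_floquetMap ha hz norm_one, zero_mul, add_zero, LinearMap.add_apply, inner_add_right,
      map_add, hre, hx, norm_add_sq_eq, add_le_add_iff_left, norm_neg, map_neg, mul_neg,
      Complex.neg_re, sub_mul, one_mul, Complex.sub_re]
    have := two_mul_abs_re_mul_le (x := v 0) (y := v (Fin.rev 0)) hz
    have h2 := le_abs_self (z * (v 0 * starRingEnd ℂ (v (Fin.rev 0)))).re
    nlinarith
  have hdn : ∀ z : ℂ, ‖z‖ = 1 → ∀ v, RCLike.re (inner ℂ v ((T - c • R y) v))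
      ≤ RCLike.re (inner ℂ v (floquetMap a b q z v)) + 0 * ‖v‖ ^ 2 := fun z hz v => by
    rw [re_inner_floquetMap ha hz norm_one, zero_mul, add_zero, LinearMap.sub_apply, inner_sub_right,
      map_sub, hre, hy, norm_add_sq_eq, sub_eq_add_neg, add_le_add_iff_left, sub_mul, one_mul,
      Complex.sub_re]
    have := two_mul_abs_re_mul_le (x := v 0) (y := v (Fin.rev 0)) hz
    have h2 := neg_abs_le (z * (v 0 * starRingEnd ℂ (v (Fin.rev 0)))).re
    nlinarith
  have hmem : ∀ z : ℂ, ∀ hz : ‖z‖ = 1, ∀ i,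
      (isSymmetric_floquetMap (b := b) ha hz).eigenvalues hn i ∈
        Set.Icc (hlo.eigenvalues hn i) (hhi.eigenvalues hn i) := fun z hz i =>
    ⟨by simpa using hlo.eigenvalues_le_add_of_re_inner_le _ hn (hdn z hz) i,
      by simpa using LinearMap.IsSymmetric.eigenvalues_le_add_of_re_inner_le _ hhi hn (hup z hz) i⟩
  refine ⟨hlo.eigenvalues hn, hhi.eigenvalues hn, fun i => ?_, ?_, ?_⟩
  · exact (hmem 1 norm_one i).1.trans (hmem 1 norm_one i).2
  · have h1 := hhi.trace_eq_sum_eigenvalues hn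
    have h2 := hlo.trace_eq_sum_eigenvalues hn
    have hxx : inner ℂ x x = 2 := by rw [hx]; simp [x, h0l, h0l.symm]; norm_num
    have hyy : inner ℂ y y = 2 := by rw [hy]; simp [y, h0l, h0l.symm]; norm_num
    have h3 : ∀ x, LinearMap.trace ℂ _ (R x) = inner ℂ x x := fun x =>
      InnerProductSpace.trace_rankOne x x
    rw [map_add, map_smul, h3, hxx] at h1
    rw [map_sub, map_smul, h3, hyy] at h2
    rw [Finset.sum_sub_distrib]
    apply Complex.ofReal_injective
    rw [Complex.ofReal_sub]
    refine (congrArg₂ (· - ·) h1.symm h2.symm).trans ?_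
    simp only [c, smul_eq_mul]
    push_cast
    ring
  · rintro r ⟨z, hz, hu⟩
    have hz0 : z ≠ 0 := norm_ne_zero_iff.1 (by simp [hz])
    obtain ⟨i, hi⟩ := (isSymmetric_floquetMap (b := b) ha hz).exists_eigenvalues_eq hn
      ((hasEigenvalue_floquetMap_iff ha hb hz0).2 hu)
    rw [Set.mem_iUnion, ← Complex.ofReal_injective hi]
    exact ⟨i, hmem z hz i⟩

theorem volume_floquetSpectrum_le {a b : ℤ → ℝ} {p : ℕ} (hp : 2 ≤ p)
    (ha : Function.Periodic a (p : ℤ)) (hb : Function.Periodic b (p : ℤ)) (n : ℤ) (ha0 : 0 ≤ a n) :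
    MeasureTheory.volume (floquetSpectrum a b p) ≤ ENNReal.ofReal (4 * a n) := by
  have hn : a (-1 + (n + 1)) = a n := by congr 1; ring
  obtain ⟨lo, hi, hle, hsum, hsub⟩ := exists_intervals_floquetSpectrum_subset
    (a := fun k => a (k + (n + 1))) (b := fun k => b (k + (n + 1))) hp
    (fun k => by beta_reduce; rw [add_right_comm, ha]) (fun k => by beta_reduce; rw [add_right_comm, hb])
    (by rw [hn]; exact ha0)
  rw [hn] at hsum
  calc MeasureTheory.volume (floquetSpectrum a b p)
      ≤ MeasureTheory.volume (⋃ i, Set.Icc (lo i) (hi i)) :=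
        MeasureTheory.measure_mono ((floquetSpectrum_subset_shift a b p _).trans hsub)
    _ ≤ ∑ i, MeasureTheory.volume (Set.Icc (lo i) (hi i)) :=
        MeasureTheory.measure_iUnion_fintype_le _ _
    _ = ENNReal.ofReal (4 * a n) := by
        simp_rw [Real.volume_Icc]
        rw [← ENNReal.ofReal_sum_of_nonneg fun i _ => sub_nonneg.2 (hle i), hsum]

/-! ### Width of the spectrum -/

/-- Rayleigh quotient of the constant sequence, which has multiplier `1`. -/
theorem sum_le_mul_of_floquetSpectrum_le {a b : ℤ → ℝ} {p : ℕ} [NeZero p]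
    (ha : Function.Periodic a (p : ℤ)) (hb : Function.Periodic b (p : ℤ)) {R : ℝ}
    (hR : ∀ r ∈ floquetSpectrum a b p, r ≤ R) :
    ∑ k ∈ Finset.range p, (a (k - 1) + b k + a k) ≤ R * p := by
  have hT := isSymmetric_floquetMap (b := b) (z := 1) ha norm_one
  let u : ℤ → ℂ := fun _ => 1
  have hu : IsQuasiPeriodic p 1 u := fun n => by simp [u]
  have h := hT.re_inner_le_of_eigenvalues_le finrank_euclideanSpace_fin
    (v := floquetRestrict p u) (r := R) fun i _ => hR _ ⟨1, norm_one,
      (hasEigenvalue_floquetMap_iff ha hb one_ne_zero).1 (hT.hasEigenvalue_eigenvalues _ i)⟩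
  rw [floquetMap, LinearMap.comp_apply, LinearMap.comp_apply,
    floquetExtend_floquetRestrict one_ne_zero hu, inner_eq_sum_range,
    EuclideanSpace.norm_sq_eq] at h
  simpa [jacobiMap_apply, u] using h

/-- Rayleigh quotient of the alternating sequence, which has multiplier `(-1) ^ p`: the off-diagonal
terms change sign and the diagonal ones do not. -/
theorem mul_le_sum_of_le_floquetSpectrum {a b : ℤ → ℝ} {p : ℕ} [NeZero p]
    (ha : Function.Periodic a (p : ℤ)) (hb : Function.Periodic b (p : ℤ)) {R : ℝ}
    (hR : ∀ r ∈ floquetSpectrum a b p, R ≤ r) :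
    R * p ≤ ∑ k ∈ Finset.range p, (-a (k - 1) + b k - a k) := by
  have hz : ‖(-1 : ℂ) ^ p‖ = 1 := by simp
  have hz0 : (-1 : ℂ) ^ p ≠ 0 := pow_ne_zero _ (by norm_num)
  have hT := isSymmetric_floquetMap (b := b) ha hz
  let u : ℤ → ℂ := fun n => (-1) ^ n
  have hu : IsQuasiPeriodic p ((-1) ^ p) u := fun n => by
    simp only [u]
    rw [zpow_add₀ (by norm_num), zpow_natCast, mul_comm]
  have h := hT.le_re_inner_of_le_eigenvalues finrank_euclideanSpace_fin
    (v := floquetRestrict p u) (r := R) fun i _ => hR _ ⟨_, hz,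
      (hasEigenvalue_floquetMap_iff ha hb hz0).1 (hT.hasEigenvalue_eigenvalues _ i)⟩
  rw [floquetMap, LinearMap.comp_apply, LinearMap.comp_apply,
    floquetExtend_floquetRestrict hz0 hu, inner_eq_sum_range,
    EuclideanSpace.norm_sq_eq] at h
  have hterm : ∀ k : ℕ, jacobiMap a b u k * starRingEnd ℂ (u k)
      = ((-a (k - 1) + b k - a k : ℝ) : ℂ) := fun k => by
    have h1 : ((-1 : ℂ) ^ k) * (-1) ^ k = 1 := by rw [← mul_pow]; norm_num
    simp only [jacobiMap_apply, u]
    rw [zpow_sub_one₀ (by norm_num), zpow_add_one₀ (by norm_num), zpow_natCast, map_pow, map_neg,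
      map_one]
    push_cast
    linear_combination (-(a (k - 1) : ℂ) + b k - a k) * h1
  simp_rw [hterm] at h
  rw [← Complex.ofReal_sum] at h
  simpa [u] using h

end

/-! ### Gap lengths and conclusion -/

theorem sum_gapLength_eq (lo hi : ℕ → ℝ) (m : ℕ) :
    ∑ i ∈ Finset.range m, gapLength lo hi i
      = hi m - lo 0 - ∑ i ∈ Finset.range (m + 1), (hi i - lo i) := by
  induction m with
  | zero => simp
  | succ m ih =>
    rw [Finset.sum_range_succ, ih, Finset.sum_range_succ _ (m + 1), gapLength]
    ring

theorem IsBandDecomposition.hi_le_lo_of_lt {p : ℕ} {S : Set ℂ} {lo hi : ℕ → ℝ}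
    (h : IsBandDecomposition p S lo hi) {i j : ℕ} (hij : i < j) (hj : j < p) : hi i ≤ lo j := by
  induction j, hij using Nat.le_induction with
  | base => exact h.hi_le_lo i hj
  | succ j hij ih =>
    exact (ih (by omega)).trans ((h.lo_lt_hi j (by omega)).le.trans (h.hi_le_lo j hj))

/-- Neighbouring closed bands may share an endpoint, so additivity is applied to the disjoint open
intervals. -/
theorem IsBandDecomposition.sum_length_le {p : ℕ} {S : Set ℂ} {lo hi : ℕ → ℝ}
    (h : IsBandDecomposition p S lo hi) :
    ENNReal.ofReal (∑ i ∈ Finset.range p, (hi i - lo i))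
      ≤ MeasureTheory.volume (⋃ i ∈ Finset.range p, Set.Icc (lo i) (hi i)) := by
  have hdisj : ∀ i j, i < j → j < p → Disjoint (Set.Ioo (lo i) (hi i)) (Set.Ioo (lo j) (hi j)) :=
    fun i j hij hj => Set.disjoint_left.2 fun x hx hx' =>
      lt_irrefl x (hx.2.trans_le ((h.hi_le_lo_of_lt hij hj).trans hx'.1.le))
  rw [ENNReal.ofReal_sum_of_nonneg fun i hi =>
    sub_nonneg.2 (h.lo_lt_hi i (Finset.mem_range.1 hi)).le]
  simp_rw [← Real.volume_Ioo]
  rw [← MeasureTheory.measure_biUnion_finset (fun i hi j hj hij => ?_)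
    fun _ _ => measurableSet_Ioo]
  · exact MeasureTheory.measure_mono (Set.iUnion₂_mono fun i _ => Set.Ioo_subset_Icc_self)
  · rcases lt_or_gt_of_ne hij with hlt | hlt
    · exact hdisj i j hlt (Finset.mem_range.1 (Finset.mem_coe.1 hj))
    · exact (hdisj j i hlt (Finset.mem_range.1 (Finset.mem_coe.1 hi))).symm

theorem IsBandDecomposition.mem_Icc {p : ℕ} {S : Set ℂ} {lo hi : ℕ → ℝ}
    (h : IsBandDecomposition p S lo hi) {r : ℝ}
    (hr : r ∈ ⋃ i ∈ Finset.range p, Set.Icc (lo i) (hi i)) :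
    r ∈ Set.Icc (lo 0) (hi (p - 1)) := by
  simp only [Set.mem_iUnion, Finset.mem_range, exists_prop] at hr
  obtain ⟨i, hip, hr⟩ := hr
  constructor
  · rcases Nat.eq_zero_or_pos i with rfl | hi0
    · exact hr.1
    · exact ((h.lo_lt_hi 0 (by omega)).le.trans (h.hi_le_lo_of_lt hi0 hip)).trans hr.1
  · rcases (Nat.le_sub_one_of_lt hip).eq_or_lt with rfl | hlt
    · exact hr.2
    · exact hr.2.trans ((h.hi_le_lo_of_lt hlt (by omega)).trans (h.lo_lt_hi _ (by omega)).le)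

theorem mul_sub_le_sum_gapLength {p : ℕ} (hp : 2 ≤ p) {a b : ℤ → ℝ}
    (ha : Function.Periodic a (p : ℤ)) (hb : Function.Periodic b (p : ℤ)) (hpos : ∀ n, 0 < a n)
    {S : Set ℂ} (hS : S = Complex.ofReal '' floquetSpectrum a b p) {lo hi : ℕ → ℝ}
    (h : IsBandDecomposition p S lo hi) :
    (2 / (p : ℝ)) * ((⨆ n, a n) - ⨅ n, a n) ≤ ∑ i ∈ Finset.range (p - 1), gapLength lo hi i := by
  have : NeZero p := ⟨by omega⟩
  have hp0 : (0 : ℝ) < p := by positivity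
  have hF : floquetSpectrum a b p = ⋃ i ∈ Finset.range p, Set.Icc (lo i) (hi i) :=
    Complex.ofReal_injective.image_injective (hS.symm.trans h.eq_union)
  set D := ∑ i ∈ Finset.range p, (hi i - lo i)
  set m := ⨅ n, a n
  have hm : ∀ n, m ≤ a n := ciInf_le ⟨0, by rintro _ ⟨n, rfl⟩; exact (hpos n).le⟩
  have hD : D ≤ 4 * m := by
    have : D / 4 ≤ m := le_ciInf fun n => by
      have h1 := h.sum_length_le.trans
        (hF ▸ volume_floquetSpectrum_le hp ha hb n (hpos n).le)
      have := hpos n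
      rw [ENNReal.ofReal_le_ofReal_iff (by linarith)] at h1
      linarith
    linarith
  have hup := sum_le_mul_of_floquetSpectrum_le ha hb (R := hi (p - 1))
    fun r hr => (h.mem_Icc (hF ▸ hr)).2
  have hdn := mul_le_sum_of_le_floquetSpectrum ha hb (R := lo 0)
    fun r hr => (h.mem_Icc (hF ▸ hr)).1
  -- The difference of the two test-vector bounds contains `2 * a (k - 1) + 2 * a k`. The excess `a
  -- n - m` is kept in the second sum only; the shifted sum is merely bounded below by `p * m`,
  -- hence the factor `2`.
  have hwidth : ∀ n, 4 * p * m + 2 * (a n - m) ≤ (hi (p - 1) - lo 0) * p := fun n => by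
    obtain ⟨k, hk, hak⟩ := ha.exists_mem_Ico₀ (by exact_mod_cast hp0) n
    obtain ⟨k, rfl⟩ := Int.eq_ofNat_of_zero_le hk.1
    have h1 : a n - m ≤ ∑ k ∈ Finset.range p, (a k - m) := by
      rw [hak]
      exact Finset.single_le_sum (f := fun k : ℕ => a k - m) (fun _ _ => sub_nonneg.2 (hm _))
        (Finset.mem_range.2 (by exact_mod_cast hk.2))
    have h2 : 0 ≤ ∑ k ∈ Finset.range p, (a ((k : ℤ) - 1) - m) :=
      Finset.sum_nonneg fun _ _ => sub_nonneg.2 (hm _)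
    simp only [Finset.sum_add_distrib, Finset.sum_sub_distrib, Finset.sum_neg_distrib,
      Finset.sum_const, Finset.card_range, nsmul_eq_mul] at h1 h2 hup hdn
    linarith
  rw [sum_gapLength_eq, Nat.sub_add_cancel (by omega)]
  change _ ≤ hi (p - 1) - lo 0 - D
  have hsup : ⨆ n, a n ≤ p / 2 * (hi (p - 1) - lo 0 - D) + m := ciSup_le fun n => by
    have := hwidth n
    have h3 : D * p ≤ 4 * m * p := by gcongr
    linarith
  rw [div_mul_eq_mul_div, div_le_iff₀ hp0]
  linarith

theorem IsBandDecomposition.mul_sum_gapLength_le {p : ℕ} (hp : 2 ≤ p) {S : Set ℂ} {lo hi : ℕ → ℝ}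
    (h : IsBandDecomposition p S lo hi) :
    ((p : ℝ) / 2) * ∑ i ∈ Finset.range (p - 1), gapLength lo hi i
      ≤ (p : ℝ) ^ 2 * √(p : ℝ) * ⨆ i : Fin (p - 1), gapLength lo hi i := by
  set G := ⨆ i : Fin (p - 1), gapLength lo hi i
  have hle : ∀ i < p - 1, gapLength lo hi i ≤ G := fun i hi' =>
    le_ciSup (f := fun i : Fin (p - 1) => gapLength lo hi i) (Set.finite_range _).bddAbove ⟨i, hi'⟩
  -- Since `2 ≤ p` there is at least one gap, so the supremum is over a nonempty index set.
  have hG : 0 ≤ G := (sub_nonneg.2 (h.hi_le_lo 0 (by omega))).trans (hle 0 (by omega))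
  have hsum : ∑ i ∈ Finset.range (p - 1), gapLength lo hi i ≤ p * G := by
    refine (Finset.sum_le_card_nsmul _ _ G fun i hi' => hle i (Finset.mem_range.1 hi')).trans ?_
    rw [Finset.card_range, nsmul_eq_mul]
    gcongr
    exact Nat.sub_le p 1
  have hs : 1 ≤ √(p : ℝ) := Real.one_le_sqrt.2 (by exact_mod_cast (by omega : 1 ≤ p))
  calc ((p : ℝ) / 2) * ∑ i ∈ Finset.range (p - 1), gapLength lo hi i
      ≤ ((p : ℝ) / 2) * (p * G) := by gcongr
    _ ≤ p ^ 2 * 1 * G := by nlinarith [mul_nonneg (sq_nonneg (p : ℝ)) hG]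
    _ ≤ p ^ 2 * √(p : ℝ) * G := by gcongr

theorem mainTheorem3 (p : ℕ) (hp : 2 ≤ p) (a b : ℤ → ℝ)
    (ha : Function.Periodic a (p : ℤ)) (hb : Function.Periodic b (p : ℤ))
    (hpos : ∀ n, 0 < a n) :
    let J : EllTwo →L[ℂ] EllTwo :=
      jacobiOperator a b (isBddSeq_of_periodic (by omega) ha) (isBddSeq_of_periodic (by omega) hb)
    (∃ lo hi : ℕ → ℝ, IsBandDecomposition p (spectrum ℂ J) lo hi) ∧
    ∀ lo hi : ℕ → ℝ, IsBandDecomposition p (spectrum ℂ J) lo hi →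
      (2 / (p : ℝ)) * ((⨆ n, a n) - ⨅ n, a n)
          ≤ ∑ i ∈ Finset.range (p - 1), gapLength lo hi i ∧
      ((p : ℝ) / 2) * ∑ i ∈ Finset.range (p - 1), gapLength lo hi i
          ≤ (p : ℝ) ^ 2 * √(p : ℝ) * ⨆ i : Fin (p - 1), gapLength lo hi i := by
  intro J
  have : NeZero p := ⟨by omega⟩
  have hJ : spectrum ℂ J = Complex.ofReal '' floquetSpectrum a b p :=
    spectrum_jacobiOperator ha hb _ _
  refine ⟨?_, fun lo hi h => ⟨mul_sub_le_sum_gapLength hp ha hb hpos hJ h,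
    h.mul_sum_gapLength_le hp⟩⟩
  obtain ⟨lo, hi, h1, h2, h3⟩ := exists_bands_floquetSpectrum ha hb fun n => (hpos n).ne'
  exact ⟨lo, hi, h1, h2, by rw [hJ, h3]⟩
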